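/- Let $n\ge 1$. (II) Let $Q_\infty\subset\mathbb{CP}^n\times\mathbb{CP}^n$ be the set of pairs $([z_0:\dots:z_n],[w_0:\dots:w_n])$ with $\sum_{j=0}^n z_jw_j=0$, let $M_{II}^{2n}=(\mathbb{CP}^n\times\mathbb{CP}^n)\setminus Q_\infty$, and let $\mathcal N=\dfrac{\|z\|^2\|w\|^2}{\left|\sum_{j=0}^n z_jw_j\right|^2}\ge 1$ on $M_{II}^{2n}$. The complete Ricci-flat Kähler metric of Stenzel and Lee on $M_{II}^{2n}$ is the metric $g_{II}$ with Kähler potential $f(\mathcal N)$, i.e. $g_{j\bar k}=\dfrac{\partial^2 f(\mathcal N)}{\partial \zeta_j\,\partial\bar \zeta_k}$ in local holomorphic coordinates $\zeta$, where $f\in C^2([1,\infty))$, $f'>0$, solves $$(2t-1)\,t^{n-1}(f')^{2n}+2(t-1)\,t^{n}(f')^{2n-1}f''=1\qquad(t\ge 1).$$ (III) Let $\omega(z,w)=\sum_{j=1}^{n+1}(z_{2j}w_{2j-1}-z_{2j-1}w_{2j})$ on $\mathbb C^{2n+2}$, let $H_\infty$ be the set of planes in the Grassmannian $\mathrm{Gr}(2,2n+2)$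 of $2$-dimensional linear subspaces of $\mathbb C^{2n+2}$ on which $\omega$ vanishes, let $M_{III}^{4n}=\mathrm{Gr}(2,2n+2)\setminus H_\infty$, and let $\mathcal N=\dfrac{\|z\|^2\|w\|^2-|\langle z,w\rangle|^2}{|\omega(z,w)|^2}\ge 1$ on $M_{III}^{4n}$, for any basis $z,w$ of the plane. The complete Ricci-flat Kähler metric of Stenzel and Lee on $M_{III}^{4n}$ is the metric $g_{III}$ with Kähler potential $f(\mathcal N)$, where $f\in C^2([1,\infty))$, $f'>0$, solves $$(2t-1)\,t^{2n-2}(f')^{4n}+2(t-1)\,t^{2n-1}(f')^{4n-1}f''=1\qquad(t\ge 1).$$ Then neither $g_{II}$ nor $g_{III}$ is projectively induced: for every $N\in\{0,1,2,\dots\}\cup\{\infty\}$ there is no holomorphic map $\Phi$ from $M_{II}^{2n}$ (respectively $M_{III}^{4n}$) to $\mathbb{CP}^N$ with $\Phi^*g_{FS}=g_{II}$ (respectively $\Phi^*g_{FS}=g_{III}$). Here $g_{FS}$ is the Fubini-Study metric, with Kähler potential $\log(1+\sum_j|z_j|^2)$ in affine coordinates, and $\mathbb{CP}^\infty$ is the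 projective space of $\ell^2$. -/

import Mathlib

open scoped Manifold ContDiff Topology lp
open Set

noncomputable section

set_option linter.unusedSectionVars false

/-! ### The Levi form -/

/-- The Levi form `∂∂̄φ` of a real function `φ` on a complex normed space, in terms of the real
second derivative.  It is complex linear in `v` and conjugate linear in `w`, and on the coordinate
vectors of `ℂⁿ` it takes the values `leviForm φ p (e j) (e k) = ∂²φ / ∂z_j ∂z̄_k (p)`. -/
def leviForm {E : Type*} [NormedAddCommGroup E] [NormedSpace ℂ E] (φ : E → ℝ) (p v w : E) : ℂ :=
  let D : E → E → ℝ := fun a b => fderiv ℝ (fun q => fderiv ℝ φ q) p a b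
  (1 / 4 : ℂ) * (((D v w + D (Complex.I • v) (Complex.I • w) : ℝ) : ℂ) +
    Complex.I * ((D v (Complex.I • w) - D (Complex.I • v) w : ℝ) : ℂ))

/-- A field of (candidate) Hermitian forms on the holomorphic tangent spaces of `M`. -/
abbrev HermitianField {E : Type*} [NormedAddCommGroup E] [NormedSpace ℂ E]
    {H : Type*} [TopologicalSpace H] (I : ModelWithCorners ℂ E H)
    (M : Type*) [TopologicalSpace M] [ChartedSpace H M] :=
  (x : M) → TangentSpace I x → TangentSpace I x → ℂ

/-- The Hermitian form on `M` with global Kähler potential `φ`, i.e. with coefficients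
`g_{j k̄} = ∂²φ / ∂z_j ∂z̄_k`. At `x` it is computed in the preferred chart at `x`, in which
`TangentSpace I x` is the model vector space. -/
def potentialMetric {E : Type*} [NormedAddCommGroup E] [NormedSpace ℂ E]
    {H : Type*} [TopologicalSpace H] (I : ModelWithCorners ℂ E H)
    {M : Type*} [TopologicalSpace M] [ChartedSpace H M] (φ : M → ℝ) : HermitianField I M :=
  fun x v w => leviForm (E := E) (φ ∘ (extChartAt I x).symm) (extChartAt I x x) v w

/-! ### Grassmannians and projective spaces as complex manifolds -/

/-- The Grassmannian of `k`-dimensional complex linear subspaces of `F ⊕ E`, with `k = dim F`. -/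
structure Gr (F E : Type*) [NormedAddCommGroup F] [InnerProductSpace ℂ F]
    [NormedAddCommGroup E] [InnerProductSpace ℂ E] where
  /-- the subspace -/
  carrier : Submodule ℂ (WithLp 2 (F × E))
  finiteDimensional : FiniteDimensional ℂ carrier
  finrank_eq : Module.finrank ℂ carrier = Module.finrank ℂ F

namespace Gr

section Charts

variable {F E : Type*} [NormedAddCommGroup F] [InnerProductSpace ℂ F]
  [NormedAddCommGroup E] [InnerProductSpace ℂ E]

theorem ext_carrier {V W : Gr F E} (h : V.carrier = W.carrier) : V = W := by
  cases V; cases W; cases h; rfl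

/-- A frame: a linear change of coordinates of the ambient space `F ⊕ E`. -/
abbrev Frame (F E : Type*) [NormedAddCommGroup F] [InnerProductSpace ℂ F]
    [NormedAddCommGroup E] [InnerProductSpace ℂ E] :=
  (F × E) ≃L[ℂ] WithLp 2 (F × E)

/-- The standard frame. -/
def stdFrame (F E : Type*) [NormedAddCommGroup F] [InnerProductSpace ℂ F]
    [NormedAddCommGroup E] [InnerProductSpace ℂ E] : Frame F E :=
  (WithLp.prodContinuousLinearEquiv 2 ℂ F E).symm

/-- The basis (parametrised by `F`) `x ↦ L (x, T x)` of the subspace with inhomogeneous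
coordinates `T` in the frame `L`. -/
def param (L : Frame F E) (T : F →L[ℂ] E) : F →ₗ[ℂ] WithLp 2 (F × E) :=
  (L : (F × E) →ₗ[ℂ] WithLp 2 (F × E)).comp (LinearMap.prod LinearMap.id (T : F →ₗ[ℂ] E))

@[simp] theorem param_apply (L : Frame F E) (T : F →L[ℂ] E) (x : F) :
    param L T x = L (x, T x) := rfl

theorem param_injective (L : Frame F E) (T : F →L[ℂ] E) :
    Function.Injective (param L T) := by
  intro x y h
  have := L.injective h
  exact congrArg Prod.fst this

variable [FiniteDimensional ℂ F]

/-- The subspace `L (graph T)`. -/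
def ofGraph (L : Frame F E) (T : F →L[ℂ] E) : Gr F E where
  carrier := LinearMap.range (param L T)
  finiteDimensional := inferInstance
  finrank_eq := LinearMap.finrank_range_of_inj (param_injective L T)

theorem mem_ofGraph {L : Frame F E} {T : F →L[ℂ] E} {v : WithLp 2 (F × E)} :
    v ∈ (ofGraph L T).carrier ↔ ∃ x, L (x, T x) = v := Iff.rfl

theorem ofGraph_injective (L : Frame F E) : Function.Injective (ofGraph L) := by
  intro T T' h
  ext x
  have h1 : L (x, T x) ∈ (ofGraph L T').carrier := by rw [← h]; exact ⟨x, rfl⟩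
  obtain ⟨y, hy⟩ := mem_ofGraph.1 h1
  have h2 := L.injective hy
  have h3 : y = x := congrArg Prod.fst h2
  have h4 : T' y = T x := congrArg Prod.snd h2
  rw [← h4, h3]

open Classical in
/-- The inhomogeneous coordinate chart attached to a frame `L`: it maps `L (graph T)` to `T`. -/
def graphChart (L : Frame F E) : PartialEquiv (Gr F E) (F →L[ℂ] E) where
  toFun V := if h : ∃ T, ofGraph L T = V then h.choose else 0
  invFun := ofGraph L
  source := Set.range (ofGraph L)
  target := Set.univ
  map_source' _ _ := Set.mem_univ _
  map_target' T _ := ⟨T, rfl⟩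
  left_inv' V hV := by
    have h : ∃ T, ofGraph L T = V := hV
    rw [dif_pos h]
    exact h.choose_spec
  right_inv' T _ := by
    have h : ∃ T', ofGraph L T' = ofGraph L T := ⟨T, rfl⟩
    rw [dif_pos h]
    exact ofGraph_injective L h.choose_spec

theorem graphChart_ofGraph (L : Frame F E) (T : F →L[ℂ] E) :
    graphChart L (ofGraph L T) = T := (graphChart L).right_inv (Set.mem_univ T)

/-- The `F`-block of the change of frame, on the graph of `T`. -/
def blockFst (L L' : Frame F E) (T : F →L[ℂ] E) : F →L[ℂ] F :=
  ((ContinuousLinearMap.fst ℂ F E).comp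
    ((L.trans L'.symm : (F × E) ≃L[ℂ] (F × E)) : (F × E) →L[ℂ] (F × E))).comp
      ((ContinuousLinearMap.id ℂ F).prod T)

/-- The `E`-block of the change of frame, on the graph of `T`. -/
def blockSnd (L L' : Frame F E) (T : F →L[ℂ] E) : F →L[ℂ] E :=
  ((ContinuousLinearMap.snd ℂ F E).comp
    ((L.trans L'.symm : (F × E) ≃L[ℂ] (F × E)) : (F × E) →L[ℂ] (F × E))).comp
      ((ContinuousLinearMap.id ℂ F).prod T)

theorem frame_blocks (L L' : Frame F E) (T : F →L[ℂ] E) (x : F) :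
    L' (blockFst L L' T x, blockSnd L L' T x) = L (x, T x) := by
  have : (blockFst L L' T x, blockSnd L L' T x) = L'.symm (L (x, T x)) := rfl
  rw [this, L'.apply_symm_apply]

theorem ofGraph_eq_iff (L L' : Frame F E) (T T' : F →L[ℂ] E) :
    ofGraph L' T' = ofGraph L T ↔
      IsUnit (blockFst L L' T) ∧ T' = (blockSnd L L' T).comp (Ring.inverse (blockFst L L' T)) := by
  constructor
  · intro h
    have key : ∀ x, T' (blockFst L L' T x) = blockSnd L L' T x := by
      intro x
      have h1 : L (x, T x) ∈ (ofGraph L' T').carrier := by rw [h]; exact ⟨x, rfl⟩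
      obtain ⟨y, hy⟩ := mem_ofGraph.1 h1
      rw [← frame_blocks L L'] at hy
      have h2 := L'.injective hy
      have h3 : y = _ := congrArg Prod.fst h2
      have h4 : T' y = _ := congrArg Prod.snd h2
      simpa [h3] using h4
    have inj : Function.Injective (blockFst L L' T) := by
      intro x y hxy
      have h1 : L (x, T x) = L (y, T y) := by
        rw [← frame_blocks L L', ← frame_blocks L L', ← key, ← key, hxy]
      exact congrArg Prod.fst (L.injective h1)
    have hu : IsUnit (blockFst L L' T) := by
      let e := (LinearEquiv.ofInjectiveEndo
        (blockFst L L' T : F →ₗ[ℂ] F) inj).toContinuousLinearEquiv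
      refine ⟨ContinuousLinearEquiv.toUnit e, ?_⟩
      ext x; rfl
    refine ⟨hu, ?_⟩
    ext x
    have : blockFst L L' T (Ring.inverse (blockFst L L' T) x) = x := by
      have := Ring.mul_inverse_cancel _ hu
      exact DFunLike.congr_fun this x
    rw [ContinuousLinearMap.comp_apply, ← key, this]
  · rintro ⟨hu, rfl⟩
    have c1 : ∀ x, blockFst L L' T (Ring.inverse (blockFst L L' T) x) = x := fun x =>
      DFunLike.congr_fun (Ring.mul_inverse_cancel _ hu) x
    have c2 : ∀ x, Ring.inverse (blockFst L L' T) (blockFst L L' T x) = x := fun x =>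
      DFunLike.congr_fun (Ring.inverse_mul_cancel _ hu) x
    apply ext_carrier
    ext v
    rw [mem_ofGraph, mem_ofGraph]
    constructor
    · rintro ⟨y, rfl⟩
      refine ⟨Ring.inverse (blockFst L L' T) y, ?_⟩
      rw [← frame_blocks L L', c1]; rfl
    · rintro ⟨x, rfl⟩
      refine ⟨blockFst L L' T x, ?_⟩
      rw [ContinuousLinearMap.comp_apply, c2, frame_blocks]

theorem transition_source (L L' : Frame F E) :
    ((graphChart L).symm.trans (graphChart L')).source =
      {T | IsUnit (blockFst L L' T)} := by
  ext T
  simp only [PartialEquiv.trans_source, PartialEquiv.symm_source, mem_inter_iff, mem_preimage,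
    mem_ofPred_eq]
  constructor
  · rintro ⟨-, T', hT'⟩
    exact ((ofGraph_eq_iff L L' T T').1 hT').1
  · intro h
    exact ⟨mem_univ _, _, (ofGraph_eq_iff L L' T _).2 ⟨h, rfl⟩⟩

theorem transition_eqOn (L L' : Frame F E) :
    Set.EqOn ((graphChart L).symm.trans (graphChart L'))
      (fun T => (blockSnd L L' T).comp (Ring.inverse (blockFst L L' T)))
      {T | IsUnit (blockFst L L' T)} := by
  intro T hT
  have h := (ofGraph_eq_iff L L' T _).2 ⟨hT, rfl⟩
  change graphChart L' (ofGraph L T) = _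
  rw [← h, graphChart_ofGraph]

theorem contDiff_blockFst (L L' : Frame F E) : ContDiff ℂ ω (blockFst L L') := by
  unfold blockFst
  have : ContDiff ℂ ω (fun T : F →L[ℂ] E => (ContinuousLinearMap.id ℂ F).prod T) := by
    have h : (fun T : F →L[ℂ] E => (ContinuousLinearMap.id ℂ F).prod T) =
      fun T => (ContinuousLinearMap.inl ℂ F E) + (ContinuousLinearMap.inr ℂ F E).comp T := by
        ext T x <;> simp
    rw [h]
    exact contDiff_const.add (contDiff_const.clm_comp contDiff_id)
  exact contDiff_const.clm_comp this

theorem contDiff_blockSnd (L L' : Frame F E) : ContDiff ℂ ω (blockSnd L L') := by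
  unfold blockSnd
  have : ContDiff ℂ ω (fun T : F →L[ℂ] E => (ContinuousLinearMap.id ℂ F).prod T) := by
    have h : (fun T : F →L[ℂ] E => (ContinuousLinearMap.id ℂ F).prod T) =
      fun T => (ContinuousLinearMap.inl ℂ F E) + (ContinuousLinearMap.inr ℂ F E).comp T := by
        ext T x <;> simp
    rw [h]
    exact contDiff_const.add (contDiff_const.clm_comp contDiff_id)
  exact contDiff_const.clm_comp this

theorem isOpen_transition (L L' : Frame F E) :
    IsOpen {T : F →L[ℂ] E | IsUnit (blockFst L L' T)} := by
  have : CompleteSpace F := FiniteDimensional.complete ℂ F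
  exact Units.isOpen.preimage (contDiff_blockFst L L').continuous

theorem contDiffOn_transition (L L' : Frame F E) :
    ContDiffOn ℂ ω ((graphChart L).symm.trans (graphChart L'))
      {T | IsUnit (blockFst L L' T)} := by
  have : CompleteSpace F := FiniteDimensional.complete ℂ F
  refine ContDiffOn.congr ?_ (transition_eqOn L L')
  refine (contDiff_blockSnd L L').contDiffOn.clm_comp ?_
  intro T hT
  obtain ⟨u, hu⟩ := hT
  have h : ContDiffAt ℂ ω Ring.inverse (blockFst L L' T) := by
    rw [← hu]; exact contDiffAt_ringInverse ℂ u
  exact (h.comp T (contDiff_blockFst L L').contDiffAt).contDiffWithinAt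

/-- In a finite dimensional space, subspaces of the same dimension are related by an
automorphism. -/
theorem exists_linearEquiv_map {S : Type*} [AddCommGroup S] [Module ℂ S] [FiniteDimensional ℂ S]
    (A B : Submodule ℂ S) (h : Module.finrank ℂ A = Module.finrank ℂ B) :
    ∃ α : S ≃ₗ[ℂ] S, A.map (α : S →ₗ[ℂ] S) = B := by
  obtain ⟨A', hA⟩ := A.exists_isCompl
  obtain ⟨B', hB⟩ := B.exists_isCompl
  have h' : Module.finrank ℂ A' = Module.finrank ℂ B' := by
    have h1 := Submodule.finrank_add_eq_of_isCompl hA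
    have h2 := Submodule.finrank_add_eq_of_isCompl hB
    omega
  let e := LinearEquiv.ofFinrankEq A B h
  let e' := LinearEquiv.ofFinrankEq A' B' h'
  let α : S ≃ₗ[ℂ] S := (Submodule.prodEquivOfIsCompl A A' hA).symm.trans
    ((e.prodCongr e').trans (Submodule.prodEquivOfIsCompl B B' hB))
  have hα : ∀ a : A, α a = e a := by
    intro a
    simp [α]
  refine ⟨α, ?_⟩
  ext b
  constructor
  · rintro ⟨a, ha, rfl⟩
    have := hα ⟨a, ha⟩
    simp only at this
    change α a ∈ B
    rw [this]; exact (e _).2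
  · intro hb
    refine ⟨e.symm ⟨b, hb⟩, (e.symm ⟨b, hb⟩).2, ?_⟩
    change α _ = b
    rw [hα]; simp

/-- In a normed space, finite dimensional subspaces of the same dimension are related by a
continuous automorphism. -/
theorem exists_continuousLinearEquiv_map {G : Type*} [NormedAddCommGroup G] [NormedSpace ℂ G]
    (A B : Submodule ℂ G) [FiniteDimensional ℂ A] [FiniteDimensional ℂ B]
    (h : Module.finrank ℂ A = Module.finrank ℂ B) :
    ∃ α : G ≃L[ℂ] G, A.map (α : G →ₗ[ℂ] G) = B := by
  let S : Submodule ℂ G := A ⊔ B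
  obtain ⟨p, hp⟩ := Submodule.ClosedComplemented.of_finiteDimensional S
  have hA : A ≤ S := le_sup_left
  have hB : B ≤ S := le_sup_right
  obtain ⟨β, hβ⟩ := exists_linearEquiv_map (A.submoduleOf S) (B.submoduleOf S) (by
    rw [(Submodule.submoduleOfEquivOfLe hA).finrank_eq,
      (Submodule.submoduleOfEquivOfLe hB).finrank_eq, h])
  let β' : S ≃L[ℂ] S := β.toContinuousLinearEquiv
  let f (γ : S →L[ℂ] S) : G →L[ℂ] G :=
    S.subtypeL.comp (γ.comp p) + (ContinuousLinearMap.id ℂ G - S.subtypeL.comp p)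
  have hf : ∀ (γ : S →L[ℂ] S) (g : G), f γ g = (γ (p g) : G) + (g - p g) := fun γ g => by simp [f]
  have hpf : ∀ (γ : S →L[ℂ] S) (g : G), p (f γ g) = γ (p g) := by
    intro γ g
    rw [hf, map_add, map_sub, hp, hp]; simp
  have hinv : ∀ (γ δ : S →L[ℂ] S), (∀ s, γ (δ s) = s) → ∀ g, f γ (f δ g) = g := by
    intro γ δ hγδ g
    rw [hf, hpf, hγδ, hf]; abel
  let α : G ≃L[ℂ] G := ContinuousLinearEquiv.equivOfInverse (f β') (f β'.symm)
    (hinv _ _ fun s => by simp) (hinv _ _ fun s => by simp)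
  have hα : ∀ s : S, α s = β s := by
    intro s
    change f β' s = _
    rw [hf, hp]; simp [β']
  refine ⟨α, ?_⟩
  ext b
  constructor
  · rintro ⟨a, ha, rfl⟩
    change α a ∈ B
    have h1 : β ⟨a, hA ha⟩ ∈ B.submoduleOf S := by
      rw [← hβ]; exact ⟨⟨a, hA ha⟩, ha, rfl⟩
    have h2 := hα ⟨a, hA ha⟩
    simp only at h2
    rw [h2]; exact h1
  · intro hb
    have h1 : (⟨b, hB hb⟩ : S) ∈ B.submoduleOf S := hb
    rw [← hβ] at h1
    obtain ⟨s, hs, hs'⟩ := h1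
    refine ⟨s, hs, ?_⟩
    change α s = b
    rw [hα]
    exact congrArg Subtype.val hs'

/-- Every point lies in the domain of some chart. -/
theorem exists_frame (V : Gr F E) : ∃ L : Frame F E, V ∈ (graphChart L).source := by
  have := V.finiteDimensional
  have := (ofGraph (stdFrame F E) 0).finiteDimensional
  obtain ⟨α, hα⟩ := exists_continuousLinearEquiv_map
    (ofGraph (stdFrame F E) 0).carrier V.carrier (by
      rw [(ofGraph (stdFrame F E) 0).finrank_eq, V.finrank_eq])
  refine ⟨(stdFrame F E).trans α, 0, ?_⟩
  apply ext_carrier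
  rw [← hα]
  ext v
  constructor
  · rintro ⟨x, rfl⟩
    exact ⟨stdFrame F E (x, 0), ⟨x, rfl⟩, rfl⟩
  · rintro ⟨_, ⟨x, rfl⟩, rfl⟩
    exact ⟨x, rfl⟩

open Classical in
/-- The frame of the preferred chart at `V`: the standard frame whenever `V` has standard
inhomogeneous coordinates, and some other frame elsewhere. -/
def frameAt (V : Gr F E) : Frame F E :=
  if V ∈ (graphChart (stdFrame F E)).source then stdFrame F E else (exists_frame V).choose

theorem mem_source_frameAt (V : Gr F E) : V ∈ (graphChart (frameAt V)).source := by
  unfold frameAt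
  split_ifs with h
  · exact h
  · exact (exists_frame V).choose_spec

variable (F E) in
/-- The atlas of all inhomogeneous coordinate charts. -/
def core : ChartedSpaceCore (F →L[ℂ] E) (Gr F E) where
  atlas := Set.range graphChart
  chartAt V := graphChart (frameAt V)
  mem_chart_source := mem_source_frameAt
  chart_mem_atlas V := ⟨_, rfl⟩
  open_source := by
    rintro _ _ ⟨L, rfl⟩ ⟨L', rfl⟩
    rw [transition_source]
    exact isOpen_transition L L'
  continuousOn_toFun := by
    rintro _ _ ⟨L, rfl⟩ ⟨L', rfl⟩
    rw [transition_source]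
    exact (contDiffOn_transition L L').continuousOn

instance : TopologicalSpace (Gr F E) := (core F E).toTopologicalSpace

instance : ChartedSpace (F →L[ℂ] E) (Gr F E) := (core F E).toChartedSpace

instance : IsManifold 𝓘(ℂ, F →L[ℂ] E) ω (Gr F E) := by
  apply isManifold_of_contDiffOn
  intro e e' he he'
  obtain ⟨L, hL⟩ : ∃ L : Frame F E, e.toPartialEquiv = graphChart L := by
    simp only [atlas, ChartedSpace.atlas, mem_iUnion, mem_singleton_iff] at he
    obtain ⟨_, ⟨L, rfl⟩, rfl⟩ := he
    exact ⟨L, rfl⟩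
  obtain ⟨L', hL'⟩ : ∃ L' : Frame F E, e'.toPartialEquiv = graphChart L' := by
    simp only [atlas, ChartedSpace.atlas, mem_iUnion, mem_singleton_iff] at he'
    obtain ⟨_, ⟨L, rfl⟩, rfl⟩ := he'
    exact ⟨L, rfl⟩
  have h := contDiffOn_transition L L'
  rw [← transition_source, ← hL, ← hL'] at h
  simpa using h

/-- A vector of a subspace extends to a continuous local section. -/
theorem exists_section (V : Gr F E) (v : WithLp 2 (F × E)) (hv : v ∈ V.carrier) :
    ∃ s : Gr F E → WithLp 2 (F × E), ContinuousAt s V ∧ s V = v ∧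
      ∀ᶠ W in 𝓝 V, s W ∈ W.carrier := by
  have h1 : ContinuousAt (chartAt (F →L[ℂ] E) V) V :=
    (chartAt (F →L[ℂ] E) V).continuousAt (mem_chart_source _ V)
  have h3 : ∀ W ∈ (chartAt (F →L[ℂ] E) V).source,
      ofGraph (frameAt V) (chartAt (F →L[ℂ] E) V W) = W :=
    fun W hW => (chartAt (F →L[ℂ] E) V).left_inv hW
  rw [← h3 V (mem_chart_source _ V)] at hv
  obtain ⟨x, hx⟩ := mem_ofGraph.1 hv
  refine ⟨fun W => frameAt V (x, chartAt (F →L[ℂ] E) V W x), ?_, hx, ?_⟩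
  · apply (frameAt V).continuous.continuousAt.comp
    exact continuousAt_const.prodMk (h1.clm_apply continuousAt_const)
  · filter_upwards [chart_source_mem_nhds (F →L[ℂ] E) V] with W hW
    have : frameAt V (x, chartAt (F →L[ℂ] E) V W x) ∈
      (ofGraph (frameAt V) (chartAt (F →L[ℂ] E) V W)).carrier := ⟨x, rfl⟩
    rwa [h3 W hW] at this

end Charts

end Gr

/-- The projective space of complex lines in `ℂ ⊕ E`. A line has homogeneous coordinates
`Z = (Z.fst, Z.snd)`, and the standard chart sends it to the linear map with value
`z = Z.snd / Z.fst` at `1`. It is `ℂP^N` for `E = ℂ^N`, and `ℂP^∞` for `E = ℓ²(ℕ, ℂ)`. -/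
abbrev CP (E : Type*) [NormedAddCommGroup E] [InnerProductSpace ℂ E] := Gr ℂ E

/-- The Fubini-Study metric, with potential `log ‖Z‖²` where `Z = L (1, z)` are the homogeneous
coordinates of the line with affine coordinate `z` in the frame `L`. In the standard frame this is
`log (1 + ‖z‖²)`. -/
def fubiniStudy (E : Type*) [NormedAddCommGroup E] [InnerProductSpace ℂ E] :
    HermitianField 𝓘(ℂ, ℂ →L[ℂ] E) (CP E) :=
  fun l v w => leviForm (E := ℂ →L[ℂ] E)
    (fun T => Real.log (‖Gr.param (Gr.frameAt l) T 1‖ ^ 2)) (chartAt (ℂ →L[ℂ] E) l l) v w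

section Induced

variable {E : Type*} [NormedAddCommGroup E] [NormedSpace ℂ E]
  {H : Type*} [TopologicalSpace H] (I : ModelWithCorners ℂ E H)
  {M : Type*} [TopologicalSpace M] [ChartedSpace H M]

/-- `Φ : M → ℂP(E')` is holomorphic and pulls the Fubini-Study metric back to `g`. -/
def IsKahlerImmersion {E' : Type*} [NormedAddCommGroup E'] [InnerProductSpace ℂ E']
    (g : HermitianField I M) (Φ : M → CP E') : Prop :=
  MDifferentiable I 𝓘(ℂ, ℂ →L[ℂ] E') Φ ∧
    ∀ (x : M) (v w : TangentSpace I x),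
      fubiniStudy E' (Φ x) (mfderiv I 𝓘(ℂ, ℂ →L[ℂ] E') Φ x v)
        (mfderiv I 𝓘(ℂ, ℂ →L[ℂ] E') Φ x w) = g x v w

/-- `g` is projectively induced: it is the pull-back of the Fubini-Study metric of `ℂP^N` by a
holomorphic map, for some `N ≤ ∞`. -/
def IsProjectivelyInduced (g : HermitianField I M) : Prop :=
  (∃ (N : ℕ) (Φ : M → CP (EuclideanSpace ℂ (Fin N))), IsKahlerImmersion I g Φ) ∨
    ∃ Φ : M → CP ℓ²(ℕ, ℂ), IsKahlerImmersion I g Φ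

end Induced

/-! ### The manifold `M_II` -/

namespace MII

/-- The vector space of homogeneous coordinates `(z_0, z_1, …, z_n)`, written `(z.fst, z.snd)`. -/
abbrev Hom (n : ℕ) := WithLp 2 (ℂ × EuclideanSpace ℂ (Fin n))

/-- `∑_{j=0}^n z_j w_j`. -/
def pairing {n : ℕ} (z w : Hom n) : ℂ := z.fst * w.fst + ∑ j, z.snd j * w.snd j

/-- The ambient manifold `ℂP^n × ℂP^n`. -/
abbrev Ambient (n : ℕ) := CP (EuclideanSpace ℂ (Fin n)) × CP (EuclideanSpace ℂ (Fin n))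

/-- The hypersurface `Q_∞`. -/
def quadric (n : ℕ) : Set (Ambient n) :=
  {p | ∀ z ∈ p.1.carrier, ∀ w ∈ p.2.carrier, pairing z w = 0}

theorem continuous_pairing (n : ℕ) : Continuous fun q : Hom n × Hom n => pairing q.1 q.2 := by
  have h1 : Continuous fun z : Hom n => z.fst :=
    (WithLp.prodContinuousLinearEquiv 2 ℂ ℂ (EuclideanSpace ℂ (Fin n))).continuous.fst
  have h2 : Continuous fun z : Hom n => z.snd :=
    (WithLp.prodContinuousLinearEquiv 2 ℂ ℂ (EuclideanSpace ℂ (Fin n))).continuous.snd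
  unfold pairing
  fun_prop

theorem isOpen_compl_quadric (n : ℕ) : IsOpen (quadric n)ᶜ := by
  rw [isOpen_iff_mem_nhds]
  rintro ⟨V, W⟩ h
  simp only [quadric, mem_compl_iff, mem_ofPred_eq, not_forall] at h
  obtain ⟨z, hz, w, hw, h⟩ := h
  obtain ⟨s, hs, rfl, hs'⟩ := Gr.exists_section V z hz
  obtain ⟨t, ht, rfl, ht'⟩ := Gr.exists_section W w hw
  have hc : ContinuousAt (fun q : Ambient n => pairing (s q.1) (t q.2)) (V, W) :=
    (continuous_pairing n).continuousAt.comp (f := fun q : Ambient n => (s q.1, t q.2))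
      ((ContinuousAt.comp (f := Prod.fst) hs continuousAt_fst).prodMk
        (ContinuousAt.comp (f := Prod.snd) ht continuousAt_snd))
  filter_upwards [hc.eventually_ne h, continuousAt_fst.eventually hs',
    continuousAt_snd.eventually ht'] with q h1 h2 h3 h4
  exact h1 (h4 _ h2 _ h3)

/-- The manifold `M_II^{2n} = ℂP^n × ℂP^n ∖ Q_∞`. -/
def space (n : ℕ) : TopologicalSpace.Opens (Ambient n) := ⟨(quadric n)ᶜ, isOpen_compl_quadric n⟩

/-- The model of `M_II^{2n}`. -/
abbrev model (n : ℕ) :=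
  (𝓘(ℂ, ℂ →L[ℂ] EuclideanSpace ℂ (Fin n))).prod 𝓘(ℂ, ℂ →L[ℂ] EuclideanSpace ℂ (Fin n))

theorem exists_rep {n : ℕ} (p : space n) :
    ∃ zw : Hom n × Hom n, zw.1 ∈ p.1.1.carrier ∧ zw.2 ∈ p.1.2.carrier ∧
      pairing zw.1 zw.2 ≠ 0 := by
  have h : p.1 ∉ quadric n := p.2
  simp only [quadric, mem_ofPred_eq, not_forall] at h
  obtain ⟨z, hz, w, hw, h⟩ := h
  exact ⟨(z, w), hz, hw, h⟩

/-- The function `𝒩 = ‖z‖² ‖w‖² / |∑ z_j w_j|²`, for any homogeneous coordinates `z`, `w`. -/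
def normFn {n : ℕ} (p : space n) : ℝ :=
  ‖(exists_rep p).choose.1‖ ^ 2 * ‖(exists_rep p).choose.2‖ ^ 2 /
    ‖pairing (exists_rep p).choose.1 (exists_rep p).choose.2‖ ^ 2

theorem normFn_eq {n : ℕ} (p : space n) (z w : Hom n) (hz : z ∈ p.1.1.carrier)
    (hw : w ∈ p.1.2.carrier) (h : pairing z w ≠ 0) :
    normFn p = ‖z‖ ^ 2 * ‖w‖ ^ 2 / ‖pairing z w‖ ^ 2 := by
  obtain ⟨h1, h2, h3⟩ := (exists_rep p).choose_spec
  unfold normFn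
  set z' := (exists_rep p).choose.1
  set w' := (exists_rep p).choose.2
  have hz0 : z ≠ 0 := by rintro rfl; exact h (by simp [pairing])
  have hw0 : w ≠ 0 := by rintro rfl; exact h (by simp [pairing])
  have key : ∀ (V : CP (EuclideanSpace ℂ (Fin n))) (z z' : Hom n), z ∈ V.carrier → z ≠ 0 →
      z' ∈ V.carrier → ∃ a : ℂ, z' = a • z := by
    intro V z z' hz hz0 hz'
    have hV : Module.finrank ℂ V.carrier = 1 := by rw [V.finrank_eq]; simp
    obtain ⟨a, ha⟩ := exists_smul_eq_of_finrank_eq_one hV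
      (x := (⟨z, hz⟩ : V.carrier)) (by simpa using hz0) ⟨z', hz'⟩
    exact ⟨a, (congrArg Subtype.val ha).symm⟩
  obtain ⟨a, ha⟩ := key _ z z' hz hz0 h1
  obtain ⟨b, hb⟩ := key _ w w' hw hw0 h2
  have hp : pairing z' w' = a * b * pairing z w := by
    rw [ha, hb]
    simp only [pairing, WithLp.smul_fst, WithLp.smul_snd, PiLp.smul_apply, smul_eq_mul, mul_add,
      Finset.mul_sum]
    congr 1
    · ring
    · exact Finset.sum_congr rfl fun j _ => by ring
  have ha0 : a ≠ 0 := by rintro rfl; exact h3 (by rw [hp]; simp)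
  have hb0 : b ≠ 0 := by rintro rfl; exact h3 (by rw [hp]; simp)
  have ha0' := norm_ne_zero_iff.2 ha0
  have hb0' := norm_ne_zero_iff.2 hb0
  have h' := norm_ne_zero_iff.2 h
  rw [hp, ha, hb]
  simp only [norm_smul, norm_mul]
  field_simp

/-- `f` is a solution on `[1, ∞)` of
`(2𝒩 - 1) 𝒩^{n-1} (f')^{2n} + 2 (𝒩 - 1) 𝒩^n (f')^{2n-1} f'' = 1`, with `f' > 0`. -/
structure IsProfile (n : ℕ) (f : ℝ → ℝ) : Prop where
  contDiffOn : ContDiffOn ℝ 2 f (Ici 1)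
  deriv_pos : ∀ t ∈ Ici (1 : ℝ), 0 < derivWithin f (Ici 1) t
  ode : ∀ t ∈ Ici (1 : ℝ),
    (2 * t - 1) * t ^ (n - 1) * (derivWithin f (Ici 1) t) ^ (2 * n) +
      2 * (t - 1) * t ^ n * (derivWithin f (Ici 1) t) ^ (2 * n - 1) *
        derivWithin (derivWithin f (Ici 1)) (Ici 1) t = 1

/-- The metric with Kähler potential `f(𝒩)`. -/
def metric (n : ℕ) (f : ℝ → ℝ) : HermitianField (model n) (space n) :=
  potentialMetric (model n) (fun p => f (normFn p))

end MII

/-! ### The manifold `M_III` -/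

namespace MIII

/-- The vector space `ℂ^{2n+2}`. The vector `(z_1, …, z_{2n+2})` is written `(z.fst, z.snd)` with
`z.fst = (z_{2n+1}, z_{2n+2})` and `z.snd = (z_1, …, z_{2n})`. -/
abbrev Hom (n : ℕ) := WithLp 2 (EuclideanSpace ℂ (Fin 2) × EuclideanSpace ℂ (Fin (2 * n)))

/-- `∑_{j=1}^{n+1} (z_{2j} w_{2j-1} - z_{2j-1} w_{2j})`. -/
def symp {n : ℕ} (z w : Hom n) : ℂ :=
  (∑ j : Fin n,
    (z.snd ⟨2 * j + 1, by omega⟩ * w.snd ⟨2 * j, by omega⟩ -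
      z.snd ⟨2 * j, by omega⟩ * w.snd ⟨2 * j + 1, by omega⟩)) +
  (z.fst 1 * w.fst 0 - z.fst 0 * w.fst 1)

/-- The Grassmannian `Gr(2, 2n+2)`. The standard chart is the one with inhomogeneous coordinates
`(z_1, …, z_{2n}, 1, 0)`, `(w_1, …, w_{2n}, 0, 1)`. -/
abbrev Ambient (n : ℕ) := Gr (EuclideanSpace ℂ (Fin 2)) (EuclideanSpace ℂ (Fin (2 * n)))

/-- The hyperplane section `H_∞`. -/
def hyperplane (n : ℕ) : Set (Ambient n) :=
  {V | ∀ z ∈ V.carrier, ∀ w ∈ V.carrier, symp z w = 0}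

theorem continuous_symp (n : ℕ) : Continuous fun q : Hom n × Hom n => symp q.1 q.2 := by
  have h1 : Continuous fun z : Hom n => z.fst :=
    (WithLp.prodContinuousLinearEquiv 2 ℂ (EuclideanSpace ℂ (Fin 2))
      (EuclideanSpace ℂ (Fin (2 * n)))).continuous.fst
  have h2 : Continuous fun z : Hom n => z.snd :=
    (WithLp.prodContinuousLinearEquiv 2 ℂ (EuclideanSpace ℂ (Fin 2))
      (EuclideanSpace ℂ (Fin (2 * n)))).continuous.snd
  unfold symp
  fun_prop

theorem isOpen_compl_hyperplane (n : ℕ) : IsOpen (hyperplane n)ᶜ := by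
  rw [isOpen_iff_mem_nhds]
  intro V h
  simp only [hyperplane, mem_compl_iff, mem_ofPred_eq, not_forall] at h
  obtain ⟨z, hz, w, hw, h⟩ := h
  obtain ⟨s, hs, rfl, hs'⟩ := Gr.exists_section V z hz
  obtain ⟨t, ht, rfl, ht'⟩ := Gr.exists_section V w hw
  have hc : ContinuousAt (fun U : Ambient n => symp (s U) (t U)) V :=
    (continuous_symp n).continuousAt.comp (f := fun U : Ambient n => (s U, t U)) (hs.prodMk ht)
  filter_upwards [hc.eventually_ne h, hs', ht'] with U h1 h2 h3 h4
  exact h1 (h4 _ h2 _ h3)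

/-- The manifold `M_III^{4n} = Gr(2, 2n+2) ∖ H_∞`. -/
def space (n : ℕ) : TopologicalSpace.Opens (Ambient n) :=
  ⟨(hyperplane n)ᶜ, isOpen_compl_hyperplane n⟩

/-- The model of `M_III^{4n}`. -/
abbrev model (n : ℕ) := 𝓘(ℂ, EuclideanSpace ℂ (Fin 2) →L[ℂ] EuclideanSpace ℂ (Fin (2 * n)))

theorem exists_rep {n : ℕ} (p : space n) :
    ∃ zw : Hom n × Hom n, zw.1 ∈ p.1.carrier ∧ zw.2 ∈ p.1.carrier ∧ symp zw.1 zw.2 ≠ 0 := by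
  have h : p.1 ∉ hyperplane n := p.2
  simp only [hyperplane, mem_ofPred_eq, not_forall] at h
  obtain ⟨z, hz, w, hw, h⟩ := h
  exact ⟨(z, w), hz, hw, h⟩

/-- `(‖z‖² ‖w‖² - |∑ z_j w̄_j|²) / |∑ (z_{2j} w_{2j-1} - z_{2j-1} w_{2j})|²`. -/
def ratio {n : ℕ} (z w : Hom n) : ℝ :=
  (‖z‖ ^ 2 * ‖w‖ ^ 2 - ‖inner ℂ z w‖ ^ 2) / ‖symp z w‖ ^ 2

/-- The function `𝒩`, computed in any basis `z`, `w` of the plane. -/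
def normFn {n : ℕ} (p : space n) : ℝ :=
  ratio (exists_rep p).choose.1 (exists_rep p).choose.2

theorem normFn_eq {n : ℕ} (p : space n) (z w : Hom n) (hz : z ∈ p.1.carrier)
    (hw : w ∈ p.1.carrier) (h : symp z w ≠ 0) : normFn p = ratio z w := by
  obtain ⟨h1, h2, h3⟩ := (exists_rep p).choose_spec
  unfold normFn
  set z' := (exists_rep p).choose.1
  set w' := (exists_rep p).choose.2
  have hself : ∀ u : Hom n, symp u u = 0 := by
    intro u
    simp only [symp]
    rw [Finset.sum_eq_zero fun j _ => by ring]
    ring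
  have hbil : ∀ a b c d : ℂ, symp (a • z + b • w) (c • z + d • w) =
      (a * d - b * c) * symp z w := by
    intro a b c d
    simp only [symp, WithLp.smul_fst, WithLp.smul_snd, WithLp.add_fst, WithLp.add_snd,
      PiLp.add_apply, PiLp.smul_apply, smul_eq_mul, mul_add, Finset.mul_sum]
    congr 1
    · exact Finset.sum_congr rfl fun j _ => by ring
    · ring
  have hspan : ∀ u ∈ p.1.carrier, ∃ a b : ℂ, u = a • z + b • w := by
    have hli : LinearIndependent ℂ ![(⟨z, hz⟩ : p.1.carrier), ⟨w, hw⟩] := by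
      rw [LinearIndependent.pair_iff]
      intro s t hst
      have hst' : s • z + t • w = 0 := congrArg Subtype.val hst
      have e1 := hbil s t 0 1
      have e2 := hbil 1 0 s t
      rw [hst'] at e1 e2
      have e0 : ∀ u : Hom n, symp 0 u = 0 := fun u => by simp [symp]
      have e0' : ∀ u : Hom n, symp u 0 = 0 := fun u => by simp [symp]
      rw [e0] at e1
      rw [e0'] at e2
      constructor
      · rcases mul_eq_zero.1 e1.symm with h' | h'
        · simpa using h'
        · exact absurd h' h
      · rcases mul_eq_zero.1 e2.symm with h' | h'
        · simpa using h'
        · exact absurd h' h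
    have hV : Module.finrank ℂ p.1.carrier = 2 := by rw [p.1.finrank_eq]; simp
    have := p.1.finiteDimensional
    have htop := hli.span_eq_top_of_card_eq_finrank (by simp [hV])
    intro u hu
    have hu' : (⟨u, hu⟩ : p.1.carrier) ∈
        Submodule.span ℂ (Set.range ![(⟨z, hz⟩ : p.1.carrier), ⟨w, hw⟩]) := by
      rw [htop]; trivial
    rw [Matrix.range_cons, Matrix.range_cons, Matrix.range_empty, Set.union_empty,
      Set.singleton_union, Submodule.mem_span_pair] at hu'
    obtain ⟨a, b, hab⟩ := hu'
    exact ⟨a, b, (congrArg Subtype.val hab).symm⟩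
  obtain ⟨a, b, hz'⟩ := hspan z' h1
  obtain ⟨c, d, hw'⟩ := hspan w' h2
  have hs := hbil a b c d
  have hdet : a * d - b * c ≠ 0 := by
    intro h0
    rw [← hz', ← hw', h0, zero_mul] at hs
    exact h3 hs
  have hg : ∀ u v : Hom n, ((‖u‖ ^ 2 * ‖v‖ ^ 2 - ‖inner ℂ u v‖ ^ 2 : ℝ) : ℂ) =
      inner ℂ u u * inner ℂ v v - inner ℂ u v * inner ℂ v u := by
    intro u v
    rw [inner_self_eq_norm_sq_to_K, inner_self_eq_norm_sq_to_K, ← inner_conj_symm v u,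
      Complex.mul_conj']
    push_cast
    rfl
  have hgram : ‖z'‖ ^ 2 * ‖w'‖ ^ 2 - ‖inner ℂ z' w'‖ ^ 2 =
      ‖a * d - b * c‖ ^ 2 * (‖z‖ ^ 2 * ‖w‖ ^ 2 - ‖inner ℂ z w‖ ^ 2) := by
    have : ((‖z'‖ ^ 2 * ‖w'‖ ^ 2 - ‖inner ℂ z' w'‖ ^ 2 : ℝ) : ℂ) =
        ((‖a * d - b * c‖ ^ 2 * (‖z‖ ^ 2 * ‖w‖ ^ 2 - ‖inner ℂ z w‖ ^ 2) : ℝ) : ℂ) := by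
      rw [Complex.ofReal_mul, hg, hg, Complex.ofReal_pow, ← Complex.conj_mul', hz', hw']
      simp only [inner_add_left, inner_add_right, inner_smul_left, inner_smul_right, map_sub,
        map_mul]
      ring
    exact_mod_cast this
  unfold ratio
  rw [hgram, hz', hw', hs, norm_mul]
  have hd := norm_ne_zero_iff.2 hdet
  have h' := norm_ne_zero_iff.2 h
  field_simp

/-- `f` is a solution on `[1, ∞)` of
`(2𝒩 - 1) 𝒩^{2n-2} (f')^{4n} + 2 (𝒩 - 1) 𝒩^{2n-1} (f')^{4n-1} f'' = 1`, with `f' > 0`. -/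
structure IsProfile (n : ℕ) (f : ℝ → ℝ) : Prop where
  contDiffOn : ContDiffOn ℝ 2 f (Ici 1)
  deriv_pos : ∀ t ∈ Ici (1 : ℝ), 0 < derivWithin f (Ici 1) t
  ode : ∀ t ∈ Ici (1 : ℝ),
    (2 * t - 1) * t ^ (2 * n - 2) * (derivWithin f (Ici 1) t) ^ (4 * n) +
      2 * (t - 1) * t ^ (2 * n - 1) * (derivWithin f (Ici 1) t) ^ (4 * n - 1) *
        derivWithin (derivWithin f (Ici 1)) (Ici 1) t = 1

/-- The metric with Kähler potential `f(𝒩)`. -/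
def metric (n : ℕ) (f : ℝ → ℝ) : HermitianField (model n) (space n) :=
  potentialMetric (model n) (fun p => f (normFn p))

end MIII

end

/-! The proof restricts the metric to a complex curve on which $\mathcal N=1+|\zeta|^2$, and shows
that already there the potential violates Calabi's positivity criterion.

For both profiles the equation integrates explicitly (`eq_radialSlope_of_ode`):
$f'(1+x)=(1+x)^{-1/2}(1+ax)^{1/(2p)}$, with $p=n$, $a=0$ in case II and $p=2n$, $a=p/(p+1)$ in case
III. Let $D$ be the primitive of this slope with $D(0)=0$. Since $a<1$, $D$ is holomorphic on the
unit disc, and along the curve the potential is $f(1)+D(|\zeta|^2)$ near $\zeta=0$.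

If the metric were induced by $\Phi$, a homogeneous lift $Z$ of $\Phi$ along the curve would give
$\log\|Z\|^2$ the same Laplacian as the potential. The difference is harmonic, hence locally the
real part of a holomorphic function, and rescaling $Z$ makes $\exp D(|\zeta|^2)=\|G(\zeta)\|^2$ with
$G$ holomorphic (`IsKahlerImmersion.exists_norm_sq_eq_exp`). Comparing expansions, the Taylor
coefficients of $h=e^D$ are the square norms of those of $G$, so they are nonnegative
(`coeff_eq_norm_sq`), and so are those of $h'$.

A power series with nonnegative coefficients is largest on the positive axis: $|h'(-x)|\le|h'(x)|$
for $0\le x<1$. But $h'=e^D D'$ stays bounded as $x\to1$, whereas $h'(-x)$ blows up like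
$(1-x)^{-1/2}$, because $D(-x)$ stays bounded. This contradiction (`not_norm_sq_eq_exp_primitive`)
is the mechanism of Pringsheim's theorem: the dominant singularity lies at $-1$ instead of on the
positive axis. No dimension enters, so finite $N$ and $N=\infty$ are treated alike. -/

/-! ### The Levi form along holomorphic curves. -/

open Laplacian in
/-- On the complex plane the Levi form is a quarter of the Laplacian. -/
theorem leviForm_one_one_re (φ : ℂ → ℝ) (ζ : ℂ) :
    (leviForm φ ζ 1 1).re = 1 / 4 * (Δ φ) ζ := by
  rw [InnerProductSpace.laplacian_eq_iteratedFDeriv_complexPlane]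
  simp [leviForm, iteratedFDeriv_two_apply]

theorem leviForm_self_re {E : Type*} [NormedAddCommGroup E] [NormedSpace ℂ E] (φ : E → ℝ)
    (p v : E) :
    (leviForm φ p v v).re = 1 / 4 * (fderiv ℝ (fun q => fderiv ℝ φ q) p v v +
      fderiv ℝ (fun q => fderiv ℝ φ q) p (Complex.I • v) (Complex.I • v)) := by
  simp [leviForm]

/-- The first-order term carries $ab$ because $\Psi''$ is complex bilinear. It therefore changes
sign between $(a,b)=(1,1)$ and $(i,i)$, and cancels in the Levi form. -/
theorem fderiv_fderiv_comp_holomorphic {E : Type*} [NormedAddCommGroup E] [NormedSpace ℂ E]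
    [CompleteSpace E] {ψ : E → ℝ} {Ψ : ℂ → E} {ζ : ℂ} (hΨ : AnalyticAt ℂ Ψ ζ)
    (hψ : ContDiffAt ℝ 2 ψ (Ψ ζ)) (a b : ℂ) :
    fderiv ℝ (fun q => fderiv ℝ (ψ ∘ Ψ) q) ζ a b =
      fderiv ℝ (fun q => fderiv ℝ ψ q) (Ψ ζ) (a • deriv Ψ ζ) (b • deriv Ψ ζ) +
        fderiv ℝ ψ (Ψ ζ) ((a * b) • deriv (deriv Ψ) ζ) := by
  have hΨR : ∀ {f : ℂ → E} {q : ℂ}, AnalyticAt ℂ f q →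
      HasFDerivAt f ((ContinuousLinearMap.toSpanSingleton ℂ (deriv f q)).restrictScalars ℝ) q :=
    fun hq => hq.differentiableAt.hasDerivAt.hasFDerivAt.restrictScalars ℝ
  have hcomp : ContDiffAt ℝ 2 (ψ ∘ Ψ) ζ :=
    hψ.comp ζ ((hΨ.contDiffAt (n := 2)).restrict_scalars ℝ)
  have hd : DifferentiableAt ℝ (fun q => fderiv ℝ (ψ ∘ Ψ) q) ζ :=
    (hcomp.fderiv_right (m := 1) (by norm_num)).differentiableAt (by norm_num)
  have hdψ : DifferentiableAt ℝ (fun q => fderiv ℝ ψ q) (Ψ ζ) :=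
    (hψ.fderiv_right (m := 1) (by norm_num)).differentiableAt (by norm_num)
  have heq : (fun q => fderiv ℝ (ψ ∘ Ψ) q b) =ᶠ[𝓝 ζ]
      fun q => fderiv ℝ ψ (Ψ q) (b • deriv Ψ q) := by
    have hev : ∀ᶠ x in 𝓝 (Ψ ζ), ContDiffAt ℝ 2 ψ x := hψ.eventually (by norm_num)
    filter_upwards [hΨ.eventually_analyticAt, hΨ.continuousAt.eventually hev] with q h1 h2
    rw [((h2.differentiableAt (by norm_num)).hasFDerivAt.comp q (hΨR h1)).fderiv]
    simp
  have h1 : fderiv ℝ (fun q => fderiv ℝ (ψ ∘ Ψ) q) ζ a b =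
      fderiv ℝ (fun q => fderiv ℝ (ψ ∘ Ψ) q b) ζ a := by
    rw [fderiv_clm_apply hd (differentiableAt_const b)]
    simp
  rw [h1, heq.fderiv_eq]
  have h2 := (hdψ.hasFDerivAt.comp ζ (hΨR hΨ)).clm_apply ((hΨR hΨ.deriv).const_smul b)
  have h3 := h2.fderiv
  change fderiv ℝ (fun q => fderiv ℝ ψ (Ψ q) (b • deriv Ψ q)) ζ = _ at h3
  rw [h3]
  simp [smul_smul, mul_comm b a, add_comm]

/-- The Levi form is natural under holomorphic curves. -/
theorem leviForm_comp_holomorphic {E : Type*} [NormedAddCommGroup E] [NormedSpace ℂ E]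
    [CompleteSpace E] {ψ : E → ℝ} {Ψ : ℂ → E} {ζ : ℂ} (hΨ : AnalyticAt ℂ Ψ ζ)
    (hψ : ContDiffAt ℝ 2 ψ (Ψ ζ)) :
    (leviForm (ψ ∘ Ψ) ζ 1 1).re = (leviForm ψ (Ψ ζ) (deriv Ψ ζ) (deriv Ψ ζ)).re := by
  rw [leviForm_self_re, leviForm_self_re, fderiv_fderiv_comp_holomorphic hΨ hψ,
    fderiv_fderiv_comp_holomorphic hΨ hψ]
  simp
  ring

/-! ### The Fubini-Study form along a curve, and homogeneous lifts. -/

section Curves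

variable {E : Type*} [NormedAddCommGroup E] [InnerProductSpace ℂ E]

theorem contDiffAt_log_norm_sq_param (L : Gr.Frame ℂ E) (T : ℂ →L[ℂ] E) :
    ContDiffAt ℝ 2 (fun T => Real.log (‖Gr.param L T 1‖ ^ 2)) T := by
  have h1 : ContDiff ℝ 2 (fun T : ℂ →L[ℂ] E => Gr.param L T 1) := by
    have : ContDiff ℂ 2 (fun T : ℂ →L[ℂ] E => L (1, T 1)) :=
      L.contDiff.comp (contDiff_const.prodMk (contDiff_id.clm_apply contDiff_const))
    exact this.restrict_scalars ℝ
  refine ContDiffAt.log (h1.norm_sq ℂ).contDiffAt ?_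
  have : Gr.param L T 1 ≠ 0 := fun h =>
    one_ne_zero ((Gr.param_injective L T) (h.trans (map_zero _).symm))
  positivity

theorem Gr.ofGraph_chartAt {V W : Gr ℂ E} (h : W ∈ (chartAt (ℂ →L[ℂ] E) V).source) :
    Gr.ofGraph (Gr.frameAt V) (chartAt (ℂ →L[ℂ] E) V W) = W :=
  (chartAt (ℂ →L[ℂ] E) V).left_inv h

theorem mfderiv_curve_one {E₀ : Type*} [NormedAddCommGroup E₀] [NormedSpace ℂ E₀]
    {H : Type*} [TopologicalSpace H] {I : ModelWithCorners ℂ E₀ H}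
    {M : Type*} [TopologicalSpace M] [ChartedSpace H M] {γ : ℂ → M} {ζ : ℂ}
    (h : MDifferentiableAt 𝓘(ℂ, ℂ) I γ ζ) :
    (mfderiv 𝓘(ℂ, ℂ) I γ ζ (1 : ℂ) : E₀) = deriv (fun η => extChartAt I (γ ζ) (γ η)) ζ := by
  rw [h.mfderiv, ← fderiv_apply_one_eq_deriv]
  simp only [writtenInExtChartAt, mfld_simps, fderivWithin_univ]
  rfl

variable [CompleteSpace E]

/-- Complex differentiability on a whole neighbourhood gives analyticity in one variable; this is
why the hypothesis is an eventual one. -/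
theorem analyticAt_chart_curve {γ : ℂ → CP E} {ζ : ℂ}
    (h : ∀ᶠ η in 𝓝 ζ, MDifferentiableAt 𝓘(ℂ, ℂ) 𝓘(ℂ, ℂ →L[ℂ] E) γ η) :
    AnalyticAt ℂ (fun η => chartAt (ℂ →L[ℂ] E) (γ ζ) (γ η)) ζ := by
  rw [Complex.analyticAt_iff_eventually_differentiableAt]
  filter_upwards [h, h.self_of_nhds.continuousAt.eventually
    (chart_source_mem_nhds (ℂ →L[ℂ] E) (γ ζ))] with η h1 h2
  have h3 : MDifferentiableAt 𝓘(ℂ, ℂ →L[ℂ] E) 𝓘(ℂ, ℂ →L[ℂ] E)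
      (chartAt (ℂ →L[ℂ] E) (γ ζ)) (γ η) :=
    (mdifferentiable_chart (I := 𝓘(ℂ, ℂ →L[ℂ] E)) (γ ζ)).mdifferentiableAt h2
  exact (h3.comp η h1).differentiableAt

open Laplacian in
/-- The Fubini-Study form along a holomorphic curve, in homogeneous coordinates. -/
theorem fubiniStudy_curve {γ : ℂ → CP E} {ζ : ℂ}
    (h : ∀ᶠ η in 𝓝 ζ, MDifferentiableAt 𝓘(ℂ, ℂ) 𝓘(ℂ, ℂ →L[ℂ] E) γ η)
    {Z : ℂ → WithLp 2 (ℂ × E)} (hZ : AnalyticAt ℂ Z ζ) (hZ0 : Z ζ ≠ 0)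
    (hmem : ∀ᶠ η in 𝓝 ζ, Z η ∈ (γ η).carrier) :
    (fubiniStudy E (γ ζ) (mfderiv 𝓘(ℂ, ℂ) 𝓘(ℂ, ℂ →L[ℂ] E) γ ζ (1 : ℂ))
      (mfderiv 𝓘(ℂ, ℂ) 𝓘(ℂ, ℂ →L[ℂ] E) γ ζ (1 : ℂ))).re =
        1 / 4 * (Δ fun η => Real.log (‖Z η‖ ^ 2)) ζ := by
  set L := Gr.frameAt (γ ζ)
  set Ψ : ℂ → ℂ →L[ℂ] E := fun η => chartAt (ℂ →L[ℂ] E) (γ ζ) (γ η)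
  have hΨ : AnalyticAt ℂ Ψ ζ := analyticAt_chart_curve h
  have hd : (mfderiv 𝓘(ℂ, ℂ) 𝓘(ℂ, ℂ →L[ℂ] E) γ ζ (1 : ℂ) : ℂ →L[ℂ] E) = deriv Ψ ζ := by
    rw [mfderiv_curve_one h.self_of_nhds]
    rfl
  have h1 : (fubiniStudy E (γ ζ) (mfderiv 𝓘(ℂ, ℂ) 𝓘(ℂ, ℂ →L[ℂ] E) γ ζ (1 : ℂ))
      (mfderiv 𝓘(ℂ, ℂ) 𝓘(ℂ, ℂ →L[ℂ] E) γ ζ (1 : ℂ))).re =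
      1 / 4 * (Δ fun η => Real.log (‖Gr.param L (Ψ η) 1‖ ^ 2)) ζ := by
    rw [← leviForm_one_one_re]
    refine Eq.trans ?_ (leviForm_comp_holomorphic hΨ (contDiffAt_log_norm_sq_param L (Ψ ζ))).symm
    rw [← hd]
    rfl
  -- Any lift is a nonvanishing holomorphic multiple $a$ of the chart's own lift, so the two
  -- potentials differ by the harmonic function $2\log|a|$.
  set a : ℂ → ℂ := fun η => (L.symm (Z η)).1
  have ha : AnalyticAt ℂ a ζ :=
    ((ContinuousLinearMap.fst ℂ ℂ E).comp
      (L.symm : WithLp 2 (ℂ × E) →L[ℂ] (ℂ × E))).analyticAt _ |>.comp hZ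
  have hrel : ∀ᶠ η in 𝓝 ζ, Z η = a η • Gr.param L (Ψ η) 1 := by
    filter_upwards [hmem, h.self_of_nhds.continuousAt.eventually
      (chart_source_mem_nhds (ℂ →L[ℂ] E) (γ ζ))] with η h2 h3
    rw [← Gr.ofGraph_chartAt h3] at h2
    obtain ⟨x, hx⟩ := Gr.mem_ofGraph.1 h2
    have hax : a η = x := by simp [a, ← hx, L]
    rw [hax, ← map_smul, smul_eq_mul, mul_one, Gr.param_apply]
    exact hx.symm
  have ha0 : a ζ ≠ 0 := by
    intro h0
    apply hZ0
    rw [hrel.self_of_nhds, h0, zero_smul]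
  have hp0 : ∀ η, Gr.param L (Ψ η) 1 ≠ 0 := fun η h =>
    one_ne_zero ((Gr.param_injective L (Ψ η)) (h.trans (map_zero _).symm))
  have hlog : (fun η => Real.log (‖Z η‖ ^ 2)) =ᶠ[𝓝 ζ]
      ((2 : ℝ) • fun η => Real.log ‖a η‖) + fun η => Real.log (‖Gr.param L (Ψ η) 1‖ ^ 2) := by
    filter_upwards [hrel, ha.continuousAt.eventually_ne ha0] with η h2 h3
    simp only [Pi.add_apply, Pi.smul_apply, smul_eq_mul]
    rw [h2, norm_smul, mul_pow, Real.log_mul (by positivity)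
      (by have := hp0 η; positivity), Real.log_pow (n := 2) (x := ‖a η‖)]
    norm_num
  have hharm := (ha.harmonicAt_log_norm ha0).const_smul (c := (2 : ℝ))
  have hcd : ContDiffAt ℝ 2 (fun η => Real.log (‖Gr.param L (Ψ η) 1‖ ^ 2)) ζ :=
    (contDiffAt_log_norm_sq_param L (Ψ ζ)).comp ζ
      ((hΨ.contDiffAt (n := 2)).restrict_scalars ℝ)
  have h5 := (InnerProductSpace.laplacian_congr_nhds hlog).self_of_nhds
  rw [h1, h5, hharm.1.laplacian_add hcd, hharm.2.self_of_nhds]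
  simp

open Laplacian in
/-- A holomorphic curve in projective space lifts to a vector valued holomorphic function `Z`, and
`log ‖Z‖²` is a potential of the Fubini-Study form along the curve. -/
theorem exists_lift_curve {γ : ℂ → CP E} {ζ : ℂ}
    (h : ∀ᶠ η in 𝓝 ζ, MDifferentiableAt 𝓘(ℂ, ℂ) 𝓘(ℂ, ℂ →L[ℂ] E) γ η) :
    ∃ Z : ℂ → WithLp 2 (ℂ × E), AnalyticAt ℂ Z ζ ∧ Z ζ ≠ 0 ∧ ∀ᶠ η in 𝓝 ζ,
      (fubiniStudy E (γ η) (mfderiv 𝓘(ℂ, ℂ) 𝓘(ℂ, ℂ →L[ℂ] E) γ η (1 : ℂ))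
        (mfderiv 𝓘(ℂ, ℂ) 𝓘(ℂ, ℂ →L[ℂ] E) γ η (1 : ℂ))).re =
          1 / 4 * (Δ fun η => Real.log (‖Z η‖ ^ 2)) η := by
  set L := Gr.frameAt (γ ζ)
  set Ψ : ℂ → ℂ →L[ℂ] E := fun η => chartAt (ℂ →L[ℂ] E) (γ ζ) (γ η)
  have hΨ : AnalyticAt ℂ Ψ ζ := analyticAt_chart_curve h
  set Z : ℂ → WithLp 2 (ℂ × E) := fun η => Gr.param L (Ψ η) 1
  have hZ : AnalyticAt ℂ Z ζ := by
    have h1 : ContDiff ℂ ω (fun T : ℂ →L[ℂ] E => L (1, T 1)) :=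
      L.contDiff.comp (contDiff_const.prodMk (contDiff_id.clm_apply contDiff_const))
    exact (h1.contDiffAt.analyticAt).comp hΨ
  have hp0 : ∀ η, Z η ≠ 0 := fun η h =>
    one_ne_zero ((Gr.param_injective L (Ψ η)) (h.trans (map_zero _).symm))
  have hmem : ∀ᶠ η in 𝓝 ζ, Z η ∈ (γ η).carrier := by
    filter_upwards [h.self_of_nhds.continuousAt.eventually
      (chart_source_mem_nhds (ℂ →L[ℂ] E) (γ ζ))] with η h3
    rw [← Gr.ofGraph_chartAt h3]
    exact ⟨1, rfl⟩
  refine ⟨Z, hZ, hp0 ζ, ?_⟩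
  filter_upwards [h.eventually_nhds, hmem.eventually_nhds, hZ.eventually_analyticAt]
    with η h1 h2 h3
  exact fubiniStudy_curve h1 h3 (hp0 η) h2

end Curves

/-! ### Potentials as logarithms of square norms. -/

open Laplacian in
/-- If `log ‖Z‖²` and `κ` have the same Laplacian, then `exp κ` is the square norm of a holomorphic
function. -/
theorem exists_norm_sq_eq_exp {E : Type*} [NormedAddCommGroup E] [InnerProductSpace ℂ E]
    [CompleteSpace E] {Z : ℂ → E} {κ : ℂ → ℝ} {ζ : ℂ} (hZ : AnalyticAt ℂ Z ζ) (hZ0 : Z ζ ≠ 0)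
    (hκ : ContDiffAt ℝ 2 κ ζ)
    (h : (Δ fun η => Real.log (‖Z η‖ ^ 2)) =ᶠ[𝓝 ζ] Δ κ) :
    ∃ G : ℂ → E, AnalyticAt ℂ G ζ ∧ ∀ᶠ η in 𝓝 ζ, ‖G η‖ ^ 2 = Real.exp (κ η) := by
  have hlog : ContDiffAt ℝ 2 (fun η => Real.log (‖Z η‖ ^ 2)) ζ := by
    refine ContDiffAt.log (((hZ.contDiffAt (n := 2)).restrict_scalars ℝ).norm_sq ℂ) ?_
    positivity
  have hharm : InnerProductSpace.HarmonicAt ((fun η => Real.log (‖Z η‖ ^ 2)) - κ) ζ := by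
    refine ⟨hlog.sub hκ, ?_⟩
    filter_upwards [h, hlog.laplacian_sub_nhds hκ] with η h1 h2
    rw [h2, Pi.sub_apply, h1, sub_self, Pi.zero_apply]
  obtain ⟨r, hr, hball⟩ := Metric.eventually_nhds_iff_ball.1 hharm.eventually
  obtain ⟨g, hg, hre⟩ :=
    InnerProductSpace.HarmonicOnNhd.exists_analyticOnNhd_ball_re_eq (z := ζ) (R := r) hball
  have hgζ := hg ζ (Metric.mem_ball_self hr)
  -- Since $\log\|Z\|^2-\kappa=\operatorname{Re} g$, the factor $e^{-g/2}$, of square modulus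
  -- $e^{-\operatorname{Re} g}$, removes exactly the discrepancy.
  refine ⟨fun η => Complex.exp (-(g η) / 2) • Z η, ?_, ?_⟩
  · exact AnalyticAt.smul (by fun_prop) hZ
  · filter_upwards [Metric.ball_mem_nhds ζ hr, hZ.continuousAt.eventually_ne hZ0] with η h1 h2
    have h3 : (g η).re = Real.log (‖Z η‖ ^ 2) - κ η := hre h1
    have h4 : 0 < ‖Z η‖ ^ 2 := by positivity
    rw [norm_smul, mul_pow, Complex.norm_exp, ← Real.exp_nat_mul]
    have h5 : ((2 : ℕ) : ℝ) * (-(g η) / 2).re = κ η - Real.log (‖Z η‖ ^ 2) := by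
      have : (-(g η) / 2).re = -(g η).re / 2 := by simp
      rw [this, h3]; push_cast; ring
    rw [h5, Real.exp_sub, Real.exp_log h4]
    field_simp

/-! ### Taylor coefficients of a radial square norm. -/

section Coefficients

variable {E : Type*} [NormedAddCommGroup E] [InnerProductSpace ℂ E]

/-- The Cauchy product of a convergent vector valued series with itself. -/
theorem hasSum_inner_antidiagonal {b : ℕ → E} {s : E} (hb : HasSum b s)
    (hn : Summable fun n => ‖b n‖) :
    HasSum (fun m => ∑ p ∈ Finset.HasAntidiagonal.antidiagonal m, inner ℂ (b p.1) (b p.2)) (inner ℂ s s) := by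
  have hsum : Summable fun p : ℕ × ℕ => inner ℂ (b p.1) (b p.2) :=
    Summable.of_norm_bounded (hn.mul_of_nonneg hn (fun _ => norm_nonneg _) fun _ => norm_nonneg _)
      fun p => norm_inner_le_norm _ _
  have h1 : HasSum (fun p : ℕ × ℕ => inner ℂ (b p.1) (b p.2)) (inner ℂ s s) := by
    have h2 : ∀ j, HasSum (fun k => inner ℂ (b j) (b k)) (inner ℂ (b j) s) := fun j =>
      hb.mapL (innerSL ℂ (b j))
    have h3 : HasSum (fun j => inner ℂ (b j) s) (inner ℂ s s) := by
      have := hb.mapL (innerSL ℂ s)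
      have h4 := (Complex.hasSum_conj').2 this
      simpa [Function.comp_def] using h4
    have h5 := hsum.hasSum.prod_fiberwise h2
    rw [← h5.unique h3]
    exact hsum.hasSum
  rw [← Finset.HasAntidiagonal.sigmaAntidiagonalEquivProd.hasSum_iff] at h1
  refine HasSum.sigma h1 fun m => ?_
  have := hasSum_fintype fun p : Finset.HasAntidiagonal.antidiagonal m => inner ℂ (b p.1.1) (b p.1.2)
  rwa [Finset.sum_coe_sort (Finset.HasAntidiagonal.antidiagonal m) fun p => inner ℂ (b p.1) (b p.2)] at this

/-- Real power series with the same sum have the same coefficients. -/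
theorem coeff_eq_of_eventually_hasSum {F : Type*} [NormedAddCommGroup F] [NormedSpace ℝ F]
    {d e : ℕ → F} {f : ℝ → F}
    (hd : ∀ᶠ r in 𝓝 (0 : ℝ), HasSum (fun m => r ^ m • d m) (f r))
    (he : ∀ᶠ r in 𝓝 (0 : ℝ), HasSum (fun m => r ^ m • e m) (f r)) : d = e := by
  let series (c : ℕ → F) : FormalMultilinearSeries ℝ ℝ F :=
    fun n => ContinuousMultilinearMap.mkPiRing ℝ (Fin n) (c n)
  have hcoeff : ∀ c n, (series c).coeff n = c n := fun c n => by
    simp [series, FormalMultilinearSeries.coeff]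
  have key : ∀ c : ℕ → F, (∀ᶠ r in 𝓝 (0 : ℝ), HasSum (fun m => r ^ m • c m) (f r)) →
      HasFPowerSeriesAt f (series c) 0 := by
    intro c hc
    rw [hasFPowerSeriesAt_iff]
    filter_upwards [hc] with r hr
    simpa [hcoeff] using hr
  have h := (key d hd).eq_formalMultilinearSeries (key e he)
  ext n
  rw [← hcoeff d, h, hcoeff]

/-- Used to conclude that a polynomial vanishing on the unit circle is zero. -/
theorem infinite_norm_eq_one : {z : ℂ | ‖z‖ = 1}.Infinite := by
  have h1 : {z : ℂ | ‖z‖ = 1} = Metric.sphere 0 1 := by ext; simp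
  rw [h1]
  refine (isPreconnected_sphere (by simp [Complex.rank_real_complex]) 0 1).infinite_of_nontrivial ?_
  exact ⟨1, by simp, -1, by simp, by norm_num⟩

/-- If `‖G ζ‖²` is a power series in `|ζ|²`, its coefficients are the square norms of the
coefficients of `G`. -/
theorem coeff_eq_norm_sq {a : ℕ → E} {c : ℕ → ℂ} {G : ℂ → E} {h : ℂ → ℂ}
    (hG : ∀ᶠ z in 𝓝 (0 : ℂ), HasSum (fun n => z ^ n • a n) (G z) ∧ Summable fun n => ‖z ^ n • a n‖)
    (hh : ∀ᶠ z in 𝓝 (0 : ℂ), HasSum (fun n => z ^ n • c n) (h z))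
    (heq : ∀ᶠ z in 𝓝 (0 : ℂ), ((‖G z‖ ^ 2 : ℝ) : ℂ) = h ((‖z‖ ^ 2 : ℝ) : ℂ)) (l : ℕ) :
    c l = ((‖a l‖ ^ 2 : ℝ) : ℂ) := by
  -- On the line $z=rw$ with $|w|=1$ fixed, both sides are power series in the real variable $r$;
  -- this compares the coefficients of $r^{2l}$.
  have hdiag : ∀ w : ℂ, ‖w‖ = 1 →
      ∑ p ∈ Finset.HasAntidiagonal.antidiagonal (2 * l), inner ℂ (w ^ p.1 • a p.1) (w ^ p.2 • a p.2) = c l := by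
    intro w hw
    have ht : Filter.Tendsto (fun r : ℝ => (r : ℂ) * w) (𝓝 0) (𝓝 0) := by
      have : Continuous fun r : ℝ => (r : ℂ) * w := by fun_prop
      simpa using this.tendsto 0
    have ht2 : Filter.Tendsto (fun r : ℝ => ((r ^ 2 : ℝ) : ℂ)) (𝓝 0) (𝓝 0) := by
      have : Continuous fun r : ℝ => ((r ^ 2 : ℝ) : ℂ) := by fun_prop
      simpa using this.tendsto 0
    have h1 : ∀ᶠ r in 𝓝 (0 : ℝ), HasSum (fun m => r ^ m •
        ∑ p ∈ Finset.HasAntidiagonal.antidiagonal m, inner ℂ (w ^ p.1 • a p.1) (w ^ p.2 • a p.2))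
        (h ((r ^ 2 : ℝ) : ℂ)) := by
      filter_upwards [ht.eventually hG, ht.eventually heq] with r h2 h3
      have h4 := hasSum_inner_antidiagonal h2.1 h2.2
      have h5 : inner ℂ (G (r * w)) (G (r * w)) = h ((r ^ 2 : ℝ) : ℂ) := by
        rw [inner_self_eq_norm_sq_to_K]
        have : ‖(r : ℂ) * w‖ ^ 2 = r ^ 2 := by simp [hw]
        rw [this] at h3
        rw [← h3]
        push_cast
        rfl
      rw [h5] at h4
      refine h4.congr_fun fun m => ?_
      rw [Finset.smul_sum]
      refine Finset.sum_congr rfl fun p hp => ?_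
      rw [← Finset.HasAntidiagonal.mem_antidiagonal.1 hp]
      simp only [inner_smul_left, inner_smul_right, mul_pow, map_mul, map_pow,
        Complex.conj_ofReal, Complex.real_smul, pow_add]
      push_cast
      ring
    -- As a series in $r$, $h(r^2)$ has only even powers; the odd coefficients are filled with $0$.
    have h6 : ∀ᶠ r in 𝓝 (0 : ℝ), HasSum (fun m => r ^ m • if Even m then c (m / 2) else 0)
        (h ((r ^ 2 : ℝ) : ℂ)) := by
      filter_upwards [ht2.eventually hh] with r h2
      have hinj : Function.Injective fun n : ℕ => 2 * n := fun x y hxy => by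
        simpa using hxy
      rw [← hinj.hasSum_iff]
      · refine h2.congr_fun fun m => ?_
        simp [pow_mul]
      · intro m hm
        have : ¬ Even m := fun ⟨k, hk⟩ => hm ⟨k, by simp only; omega⟩
        simp [this]
    have h7 := congrFun (coeff_eq_of_eventually_hasSum h1 h6) (2 * l)
    simpa using h7
  -- Multiplying the identity on the circle by $w^{2l}$ and using $\bar w w=1$ with $j+k=2l$ turns
  -- $\bar w^j w^k$ into $w^{2k}$. This gives a genuine polynomial identity, whose coefficient at
  -- $w^{2l}$ isolates the diagonal term $j=k=l$.
  set P : Polynomial ℂ := (∑ p ∈ Finset.HasAntidiagonal.antidiagonal (2 * l),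
    Polynomial.monomial (2 * p.2) (inner ℂ (a p.1) (a p.2))) - Polynomial.monomial (2 * l) (c l)
  have hP : P = 0 := by
    refine Polynomial.eq_zero_of_infinite_isRoot P (infinite_norm_eq_one.mono fun w hw => ?_)
    have hw' : ‖w‖ = 1 := hw
    have hcw : (starRingEnd ℂ) w * w = 1 := by
      rw [Complex.conj_mul', hw']; simp
    change P.IsRoot w
    simp only [P, Polynomial.IsRoot, Polynomial.eval_sub, Polynomial.eval_finsetSum,
      Polynomial.eval_monomial]
    rw [sub_eq_zero, ← hdiag w hw', Finset.sum_mul]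
    refine Finset.sum_congr rfl fun p hp => ?_
    rw [← Finset.HasAntidiagonal.mem_antidiagonal.1 hp, inner_smul_left, inner_smul_right, map_pow]
    have : (starRingEnd ℂ) w ^ p.1 * w ^ p.1 = 1 := by rw [← mul_pow, hcw, one_pow]
    rw [pow_add, two_mul, pow_add]
    linear_combination (-(w ^ p.2 * w ^ p.2 * inner ℂ (a p.1) (a p.2))) * this
  have hcoef : P.coeff (2 * l) = 0 := by rw [hP]; simp
  simp only [P, Polynomial.coeff_sub, Polynomial.finsetSum_coeff,
    Polynomial.coeff_monomial] at hcoef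
  rw [Finset.sum_eq_single (l, l)] at hcoef
  · have h8 : inner ℂ (a l) (a l) = ((‖a l‖ ^ 2 : ℝ) : ℂ) := by
      rw [inner_self_eq_norm_sq_to_K]; push_cast; rfl
    simp only [if_true] at hcoef
    rw [← h8]
    exact (sub_eq_zero.1 hcoef).symm
  · intro p hp hne
    rw [if_neg]
    intro h9
    have := Finset.HasAntidiagonal.mem_antidiagonal.1 hp
    exact hne (Prod.ext (by simp only; omega) (by simp only; omega))
  · intro h9
    exact absurd (Finset.HasAntidiagonal.mem_antidiagonal.2 (by simp only; ring)) h9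

open scoped Nat in
/-- If `exp κ` is the square norm of a holomorphic function, where `exp κ` is a holomorphic
function of `|ζ|²`, then the Taylor coefficients of that function are nonnegative. -/
theorem iteratedDeriv_nonneg_of_norm_sq [CompleteSpace E] {G : ℂ → E} {h : ℂ → ℂ}
    (hG : AnalyticAt ℂ G 0) (hh : AnalyticAt ℂ h 0)
    (heq : ∀ᶠ z in 𝓝 (0 : ℂ), ((‖G z‖ ^ 2 : ℝ) : ℂ) = h ((‖z‖ ^ 2 : ℝ) : ℂ)) (l : ℕ) :
    ∃ r : ℝ, 0 ≤ r ∧ iteratedDeriv l h 0 = r := by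
  obtain ⟨p, hp⟩ := hG
  have h1 : ∀ᶠ z in 𝓝 (0 : ℂ), HasSum (fun n => z ^ n • p.coeff n) (G z) ∧
      Summable fun n => ‖z ^ n • p.coeff n‖ := by
    have hr := hp.radius_pos
    filter_upwards [(hasFPowerSeriesAt_iff.1 hp), Metric.eball_mem_nhds (0 : ℂ) hr] with z h2 h3
    refine ⟨by simpa using h2, ?_⟩
    have := p.summable_norm_apply h3
    refine this.congr fun n => ?_
    rw [FormalMultilinearSeries.apply_eq_pow_smul_coeff]
  have h2 : ∀ᶠ z in 𝓝 (0 : ℂ),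
      HasSum (fun n => z ^ n • ((n ! : ℂ)⁻¹ * iteratedDeriv n h 0)) (h z) := by
    obtain ⟨r, hr, hd⟩ := Metric.eventually_nhds_iff_ball.1 hh.eventually_analyticAt
    filter_upwards [Metric.ball_mem_nhds (0 : ℂ) hr] with z hz
    have := Complex.hasSum_taylorSeries_on_ball (r := r)
      (fun w hw => (hd w hw).differentiableAt.differentiableWithinAt) hz
    refine this.congr_fun fun n => ?_
    simp only [sub_zero, smul_eq_mul]
    ring
  have h3 := coeff_eq_norm_sq h1 h2 heq l
  refine ⟨l ! * ‖p.coeff l‖ ^ 2, by positivity, ?_⟩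
  have h4 : (l ! : ℂ) ≠ 0 := by exact_mod_cast l.factorial_ne_zero
  push_cast at h3 ⊢
  rw [← h3]
  field_simp

end Coefficients

/-! ### The radial potential and its growth near $\pm1$. -/

/-- The derivative of the radial potential, `x ↦ (1 + x)^{-1/2} (1 + a x)^b`. -/
noncomputable def radialSlope (a b x : ℝ) : ℝ := (1 + x) ^ (-1 / 2 : ℝ) * (1 + a * x) ^ b

/-- On the unit disc $1+z$ and $1+az$ have positive real part, so the principal powers are
holomorphic there, and a disc admits primitives. -/
theorem exists_primitive_radialSlope {a : ℝ} (ha0 : 0 ≤ a) (ha1 : a < 1) (b : ℝ) :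
    ∃ D : ℂ → ℂ, D 0 = 0 ∧ DifferentiableOn ℂ D (Metric.ball 0 1) ∧
      (∀ x : ℝ, |x| < 1 → HasDerivAt D (radialSlope a b x) x) ∧
      ∀ x : ℝ, |x| < 1 → D x = ((D x).re : ℂ) := by
  set u : ℂ → ℂ := fun z => (1 + z) ^ ((-1 / 2 : ℝ) : ℂ) * (1 + a * z) ^ (b : ℂ)
  have hre : ∀ z ∈ Metric.ball (0 : ℂ) 1, |z.re| < 1 := fun z hz =>
    (Complex.abs_re_le_norm z).trans_lt (by simpa using hz)
  have hlin : ∀ x : ℝ, |x| < 1 → 0 < 1 + x ∧ 0 < 1 + a * x := by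
    intro x hx
    have := abs_lt.1 hx
    constructor <;> nlinarith
  have hu : DifferentiableOn ℂ u (Metric.ball 0 1) := by
    intro z hz
    obtain ⟨h1, h2⟩ := hlin _ (hre z hz)
    have s1 : 1 + z ∈ Complex.slitPlane := Or.inl (by simpa using h1)
    have s2 : 1 + a * z ∈ Complex.slitPlane := Or.inl (by simpa using h2)
    refine DifferentiableAt.differentiableWithinAt ?_
    exact (DifferentiableAt.cpow (by fun_prop) (by fun_prop) s1).mul
      (DifferentiableAt.cpow (by fun_prop) (by fun_prop) s2)
  obtain ⟨D, hD0, hD⟩ := hu.isExactOn_ball.with_val_at 0 0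
  have hball : ∀ x : ℝ, |x| < 1 → (x : ℂ) ∈ Metric.ball (0 : ℂ) 1 := fun x hx => by simpa using hx
  have hux : ∀ x : ℝ, |x| < 1 → HasDerivAt D (radialSlope a b x) x := by
    intro x hx
    obtain ⟨h1, h2⟩ := hlin x hx
    have : ((radialSlope a b x : ℝ) : ℂ) = u x := by
      simp only [radialSlope, u]
      rw [Complex.ofReal_mul, Complex.ofReal_cpow h1.le, Complex.ofReal_cpow h2.le]
      push_cast
      rfl
    rw [this]
    exact hD _ (hball x hx)
  refine ⟨D, hD0, fun z hz => (hD z hz).differentiableAt.differentiableWithinAt, hux, ?_⟩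
  -- The derivative of $D$ is real on the real axis, so $\operatorname{Im} D$ is constant there, and
  -- it vanishes at $0$.
  have him : ∀ x ∈ Ioo (-1 : ℝ) 1, (D x).im = (D (0 : ℝ)).im := by
    have hder : ∀ x ∈ Ioo (-1 : ℝ) 1, HasDerivAt (fun x : ℝ => (D x).im) 0 x := by
      intro x hx
      have := ((hux x (abs_lt.2 hx)).const_mul (-Complex.I)).real_of_complex
      simpa using this
    intro x hx
    refine (convex_Ioo (-1 : ℝ) 1).is_const_of_fderivWithin_eq_zero (𝕜 := ℝ)
      (f := fun x : ℝ => (D x).im)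
      (fun y hy => (hder y hy).differentiableAt.differentiableWithinAt) (fun y hy => ?_) hx
      (by norm_num)
    rw [fderivWithin_of_isOpen isOpen_Ioo hy]
    exact (hder y hy).hasFDerivAt.fderiv.trans (by ext; simp)
  intro x hx
  apply Complex.ext
  · simp
  · rw [him x (abs_lt.1 hx)]
    simp [hD0]

theorem radialSlope_le {a b x : ℝ} (ha0 : 0 ≤ a) (ha1 : a < 1) (hb : 0 ≤ b) (hx0 : 0 ≤ x) (hx1 : x < 1) :
    radialSlope a b x ≤ 2 ^ b := by
  have h1 : (1 + x) ^ (-1 / 2 : ℝ) ≤ 1 :=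
    Real.rpow_le_one_of_one_le_of_nonpos (by linarith) (by norm_num)
  have h2 : (1 + a * x) ^ b ≤ 2 ^ b := Real.rpow_le_rpow (by positivity) (by nlinarith) hb
  calc radialSlope a b x ≤ 1 * 2 ^ b := mul_le_mul h1 h2 (by positivity) (by norm_num)
    _ = 2 ^ b := one_mul _

theorem radialSlope_neg_le {a b x : ℝ} (ha0 : 0 ≤ a) (ha1 : a < 1) (hb : 0 ≤ b) (hx0 : 0 ≤ x)
    (hx1 : x < 1) : radialSlope a b (-x) ≤ (1 - x) ^ (-1 / 2 : ℝ) := by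
  have h2 : (1 + a * -x) ^ b ≤ 1 := Real.rpow_le_one (by nlinarith) (by nlinarith) hb
  have h3 : 0 ≤ (1 - x) ^ (-1 / 2 : ℝ) := Real.rpow_nonneg (by linarith) _
  calc radialSlope a b (-x) = (1 - x) ^ (-1 / 2 : ℝ) * (1 + a * -x) ^ b := by simp [radialSlope, sub_eq_add_neg]
    _ ≤ (1 - x) ^ (-1 / 2 : ℝ) := mul_le_of_le_one_right h3 h2

/-- The factor $(1-ax)^b$ stays above $(1-a)^b>0$ because $a<1$, so it cannot compensate the
singularity of $(1-x)^{-1/2}$ at $1$. -/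
theorem le_radialSlope_neg {a b x : ℝ} (ha0 : 0 ≤ a) (ha1 : a < 1) (hb : 0 ≤ b)
    (hx1 : x < 1) : (1 - a) ^ b * (1 - x) ^ (-1 / 2 : ℝ) ≤ radialSlope a b (-x) := by
  have h2 : (1 - a) ^ b ≤ (1 + a * -x) ^ b :=
    Real.rpow_le_rpow (by linarith) (by nlinarith) hb
  have h3 : 0 ≤ (1 - x) ^ (-1 / 2 : ℝ) := Real.rpow_nonneg (by linarith) _
  calc (1 - a) ^ b * (1 - x) ^ (-1 / 2 : ℝ) ≤ (1 + a * -x) ^ b * (1 - x) ^ (-1 / 2 : ℝ) := by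
        gcongr
    _ = radialSlope a b (-x) := by simp [radialSlope, sub_eq_add_neg, mul_comm]

theorem radialSlope_nonneg {a b x : ℝ} (ha0 : 0 ≤ a) (ha1 : a < 1) (hx : |x| < 1) :
    0 ≤ radialSlope a b x := by
  have := abs_lt.1 hx
  exact mul_nonneg (Real.rpow_nonneg (by linarith) _) (Real.rpow_nonneg (by nlinarith) _)

theorem primitive_le {d : ℝ → ℝ} {a b : ℝ} (ha0 : 0 ≤ a) (ha1 : a < 1) (hb : 0 ≤ b) (hd0 : d 0 = 0)
    (hd : ∀ x : ℝ, |x| < 1 → HasDerivAt d (radialSlope a b x) x) {x : ℝ} (hx0 : 0 ≤ x) (hx1 : x < 1) :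
    d x ≤ 2 ^ b := by
  have habs : ∀ y ∈ Ico (0 : ℝ) 1, |y| < 1 := fun y hy => by rw [abs_of_nonneg hy.1]; exact hy.2
  have hder : ∀ y ∈ Ico (0 : ℝ) 1, HasDerivAt (fun y => d y - 2 ^ b * y) (radialSlope a b y - 2 ^ b) y :=
    fun y hy =>
      ((hd y (habs y hy)).sub ((hasDerivAt_id y).const_mul (2 ^ b))).congr_deriv (by rw [mul_one])
  have hanti : AntitoneOn (fun y => d y - 2 ^ b * y) (Ico 0 1) := by
    refine antitoneOn_of_deriv_nonpos (convex_Ico 0 1)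
      (fun y hy => (hder y hy).continuousAt.continuousWithinAt)
      (fun y hy => (hder y (interior_subset hy)).differentiableAt.differentiableWithinAt)
      fun y hy => ?_
    have hy' := interior_subset hy
    rw [(hder y hy').deriv]
    linarith [radialSlope_le ha0 ha1 hb hy'.1 hy'.2]
  have h := hanti (by simp) (show x ∈ Ico (0 : ℝ) 1 from ⟨hx0, hx1⟩) hx0
  simp only [hd0, mul_zero, sub_zero] at h
  have : (0 : ℝ) < 2 ^ b := by positivity
  nlinarith

/-- The singularity at $-1$ is integrable: the slope at $-y$ is at most $(1-y)^{-1/2}$, whose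
integral from $0$ to $x$ is $2-2(1-x)^{1/2}\le2$. Hence $e^D$ stays away from $0$ where its
derivative is to blow up. -/
theorem neg_two_le_primitive {d : ℝ → ℝ} {a b : ℝ} (ha0 : 0 ≤ a) (ha1 : a < 1) (hb : 0 ≤ b)
    (hd0 : d 0 = 0) (hd : ∀ x : ℝ, |x| < 1 → HasDerivAt d (radialSlope a b x) x) {x : ℝ} (hx0 : 0 ≤ x)
    (hx1 : x < 1) : -2 ≤ d (-x) := by
  have habs : ∀ y ∈ Ico (0 : ℝ) 1, |-y| < 1 := fun y hy => by
    rw [abs_neg, abs_of_nonneg hy.1]; exact hy.2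
  have hder : ∀ y ∈ Ico (0 : ℝ) 1, HasDerivAt (fun y => d (-y) - 2 * (1 - y) ^ (1 / 2 : ℝ))
      ((1 - y) ^ (-1 / 2 : ℝ) - radialSlope a b (-y)) y := by
    intro y hy
    have h1 := (hd (-y) (habs y hy)).comp y (hasDerivAt_neg y)
    have h2 := ((hasDerivAt_id y).const_sub 1).rpow_const (p := 1 / 2)
      (Or.inl (by simp; linarith [hy.2]))
    have h3 := h1.sub (h2.const_mul 2)
    refine h3.congr_deriv ?_
    simp only [id]
    norm_num
    ring
  have hmono : MonotoneOn (fun y => d (-y) - 2 * (1 - y) ^ (1 / 2 : ℝ)) (Ico 0 1) := by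
    refine monotoneOn_of_deriv_nonneg (convex_Ico 0 1)
      (fun y hy => (hder y hy).continuousAt.continuousWithinAt)
      (fun y hy => (hder y (interior_subset hy)).differentiableAt.differentiableWithinAt)
      fun y hy => ?_
    have hy' := interior_subset hy
    rw [(hder y hy').deriv]
    linarith [radialSlope_neg_le ha0 ha1 hb hy'.1 hy'.2]
  have h := hmono (by simp) (show x ∈ Ico (0 : ℝ) 1 from ⟨hx0, hx1⟩) hx0
  have h4 : 0 ≤ (1 - x) ^ (1 / 2 : ℝ) := Real.rpow_nonneg (by linarith) _
  simp only [hd0, neg_zero, sub_zero, Real.one_rpow] at h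
  linarith

open scoped Nat in
/-- A holomorphic function on the unit disc with nonnegative Taylor coefficients is dominated by
its values on the positive axis. -/
theorem norm_neg_le_of_iteratedDeriv_nonneg {h : ℂ → ℂ} (hh : DifferentiableOn ℂ h (Metric.ball 0 1))
    (hnn : ∀ l, ∃ r : ℝ, 0 ≤ r ∧ iteratedDeriv l h 0 = r) {x : ℝ} (hx0 : 0 ≤ x) (hx1 : x < 1) :
    ‖h (-x : ℝ)‖ ≤ ‖h x‖ := by
  choose c hc0 hc using hnn
  have hball : ∀ y : ℝ, |y| < 1 → (y : ℂ) ∈ Metric.ball (0 : ℂ) 1 := fun y hy => by simpa using hy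
  have hs : ∀ y : ℝ, |y| < 1 →
      HasSum (fun n => (((n ! : ℝ)⁻¹ * y ^ n * c n : ℝ) : ℂ)) (h y) := by
    intro y hy
    have := Complex.hasSum_taylorSeries_on_ball hh (hball y hy)
    refine this.congr_fun fun n => ?_
    rw [hc]
    simp only [sub_zero, smul_eq_mul]
    push_cast
    ring
  have h1 := hs x (by rwa [abs_of_nonneg hx0])
  have h2 := hs (-x) (by rwa [abs_neg, abs_of_nonneg hx0])
  have hsum : HasSum (fun n => (n ! : ℝ)⁻¹ * x ^ n * c n) (h x).re :=
    h1.mapL Complex.reCLM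
  refine le_trans ?_ ((le_abs_self _).trans (Complex.abs_re_le_norm (h x)))
  rw [← h2.tsum_eq]
  refine tsum_of_norm_bounded hsum fun n => ?_
  rw [Complex.norm_real, Real.norm_eq_abs, abs_mul, abs_mul, abs_pow, abs_neg,
    abs_of_nonneg hx0, abs_of_nonneg (hc0 n), abs_of_nonneg (by positivity)]

/-- The radial potential with derivative `radialSlope a b` is not the logarithm of the square norm of
a holomorphic function. -/
theorem not_norm_sq_eq_exp_primitive {E : Type*} [NormedAddCommGroup E] [InnerProductSpace ℂ E]
    [CompleteSpace E] {a b : ℝ} (ha0 : 0 ≤ a) (ha1 : a < 1) (hb : 0 ≤ b) {D : ℂ → ℂ}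
    (hD0 : D 0 = 0) (hD : DifferentiableOn ℂ D (Metric.ball 0 1))
    (hDx : ∀ x : ℝ, |x| < 1 → HasDerivAt D (radialSlope a b x) x)
    (hDr : ∀ x : ℝ, |x| < 1 → D x = ((D x).re : ℂ)) {G : ℂ → E} (hG : AnalyticAt ℂ G 0)
    (heq : ∀ᶠ z in 𝓝 (0 : ℂ), ‖G z‖ ^ 2 = Real.exp (D ((‖z‖ ^ 2 : ℝ) : ℂ)).re) : False := by
  set h : ℂ → ℂ := fun z => Complex.exp (D z)
  have hh : DifferentiableOn ℂ h (Metric.ball 0 1) := hD.cexp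
  have hnn := iteratedDeriv_nonneg_of_norm_sq (h := h) hG
    (hh.analyticAt (Metric.ball_mem_nhds 0 one_pos)) (by
      have hc : Filter.Tendsto (fun z : ℂ => ‖z‖ ^ 2) (𝓝 0) (𝓝 0) := by
        have : Continuous fun z : ℂ => ‖z‖ ^ 2 := by fun_prop
        simpa using this.tendsto 0
      have h1 : ∀ᶠ z in 𝓝 (0 : ℂ), ‖z‖ ^ 2 < 1 := hc.eventually (gt_mem_nhds one_pos)
      filter_upwards [heq, h1] with z h2 h3
      rw [h2, Complex.ofReal_exp, ← hDr _ (by rwa [abs_of_nonneg (by positivity)])])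
  -- The comparison is made for $h'$, since $h=e^D$ itself remains bounded along the real axis near
  -- $-1$ and would give no contradiction. Differentiation only shifts the list of derivatives at
  -- $0$.
  have hdh : DifferentiableOn ℂ (deriv h) (Metric.ball 0 1) := hh.deriv Metric.isOpen_ball
  have hdnn : ∀ l, ∃ r : ℝ, 0 ≤ r ∧ iteratedDeriv l (deriv h) 0 = r := by
    intro l
    rw [← iteratedDeriv_succ']
    exact hnn (l + 1)
  have hnorm : ∀ x : ℝ, |x| < 1 → ‖deriv h x‖ = Real.exp (D x).re * radialSlope a b x := by
    intro x hx
    rw [(hDx x hx).cexp.deriv, norm_mul, Complex.norm_exp, Complex.norm_real, Real.norm_eq_abs,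
      abs_of_nonneg (radialSlope_nonneg ha0 ha1 hx)]
  set d : ℝ → ℝ := fun x => (D x).re
  have hd0 : d 0 = 0 := by simp [d, hD0]
  have hd : ∀ x : ℝ, |x| < 1 → HasDerivAt d (radialSlope a b x) x := fun x hx => by
    simpa using (hDx x hx).real_of_complex
  have hbound : ∀ x : ℝ, 0 ≤ x → x < 1 →
      Real.exp (-2) * ((1 - a) ^ b * (1 - x) ^ (-1 / 2 : ℝ)) ≤ Real.exp (2 ^ b) * 2 ^ b := by
    intro x hx0 hx1
    have hx : |x| < 1 := by rwa [abs_of_nonneg hx0]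
    have h1 := norm_neg_le_of_iteratedDeriv_nonneg hdh hdnn hx0 hx1
    rw [hnorm x hx, hnorm (-x) (by rwa [abs_neg])] at h1
    have h2 : d x ≤ 2 ^ b := primitive_le ha0 ha1 hb hd0 hd hx0 hx1
    have h3 : -2 ≤ d (-x) := neg_two_le_primitive ha0 ha1 hb hd0 hd hx0 hx1
    have h4 := le_radialSlope_neg ha0 ha1 hb hx1
    have h5 := radialSlope_le ha0 ha1 hb hx0 hx1
    have h6 : 0 ≤ (1 - a) ^ b * (1 - x) ^ (-1 / 2 : ℝ) :=
      mul_nonneg (Real.rpow_nonneg (by linarith) _) (Real.rpow_nonneg (by linarith) _)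
    calc Real.exp (-2) * ((1 - a) ^ b * (1 - x) ^ (-1 / 2 : ℝ))
        ≤ Real.exp (d (-x)) * radialSlope a b (-x) :=
          mul_le_mul (Real.exp_le_exp.2 h3) h4 h6 (Real.exp_nonneg _)
      _ ≤ Real.exp (d x) * radialSlope a b x := h1
      _ ≤ Real.exp (2 ^ b) * 2 ^ b :=
          mul_le_mul (Real.exp_le_exp.2 h2) h5 (radialSlope_nonneg ha0 ha1 hx) (Real.exp_nonneg _)
  set A := Real.exp (-2) * (1 - a) ^ b
  set B := Real.exp (2 ^ b) * (2 : ℝ) ^ b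
  have hA : 0 < A := mul_pos (Real.exp_pos _) (Real.rpow_pos_of_pos (by linarith) _)
  have hB : 0 < B := by positivity
  -- At $x=1-t^{-2}$ the singular factor $(1-x)^{-1/2}$ equals $t$, so the bound reads $At\le B$,
  -- while this choice of $t$ gives $At=A+B$.
  set t := B / A + 1
  have ht : 1 < t := by simp only [t]; linarith [div_pos hB hA]
  have ht0 : 0 < t := by linarith
  have h7 := hbound (1 - t ^ (-2 : ℝ))
    (by linarith [Real.rpow_le_one_of_one_le_of_nonpos ht.le (show (-2 : ℝ) ≤ 0 by norm_num)])
    (by linarith [Real.rpow_pos_of_pos ht0 (-2)])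
  rw [sub_sub_cancel, ← Real.rpow_mul ht0.le] at h7
  norm_num at h7
  have h8 : A * t ≤ B := by
    simp only [A]
    rw [mul_assoc]
    exact h7
  have h9 : A * t = B + A := by simp only [t]; field_simp
  linarith

/-! ### Integrating the profile equation. -/

/-- First integral of the profile equation. -/
theorem eq_radialSlope_of_ode {p : ℕ} (hp : 1 ≤ p) {a c : ℝ} (ha0 : 0 ≤ a)
    (hc : c * p = a * (p + 1)) {u : ℝ → ℝ} (hu : DifferentiableOn ℝ u (Ici 1))
    (hpos : ∀ t ∈ Ici (1 : ℝ), 0 < u t)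
    (hode : ∀ t ∈ Ici (1 : ℝ), (2 * t - 1) * t ^ (p - 1) * u t ^ (2 * p) +
      2 * (t - 1) * t ^ p * u t ^ (2 * p - 1) * derivWithin u (Ici 1) t = 1 + c * (t - 1))
    {t : ℝ} (ht : 1 ≤ t) : u t = radialSlope a (1 / (2 * p)) (t - 1) := by
  obtain ⟨q, rfl⟩ : ∃ q, p = q + 1 := ⟨p - 1, by omega⟩
  have e1 : 2 * (q + 1) - 1 = 2 * q + 1 := by omega
  simp only [Nat.add_sub_cancel, e1] at hode
  push_cast at hc
  -- After multiplication by $p(t-1)^{p-1}$, $p=q+1$, the left side of the equation is the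
  -- derivative of $(t(t-1))^p u^{2p}$ and the right side that of $(t-1)^p(1+a(t-1))$; the relation
  -- between $a$ and $c$ makes the latter true.
  set W : ℝ → ℝ := fun t => (t * (t - 1)) ^ (q + 1) * u t ^ (2 * (q + 1)) -
    (t - 1) ^ (q + 1) * (1 + a * (t - 1))
  have hW : ∀ t ∈ Ici (1 : ℝ), HasDerivWithinAt W 0 (Ici 1) t := by
    intro t ht
    have h1 : HasDerivWithinAt u (derivWithin u (Ici 1) t) (Ici 1) t :=
      (hu t ht).hasDerivWithinAt
    have h2 : HasDerivWithinAt (fun t : ℝ => t - 1) 1 (Ici 1) t :=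
      (hasDerivWithinAt_id t _).sub_const 1
    have h3 := ((((hasDerivWithinAt_id t (Ici (1 : ℝ))).mul h2).pow (q + 1)).mul
      (h1.pow (2 * (q + 1)))).sub ((h2.pow (q + 1)).mul ((h2.const_mul a).const_add 1))
    refine h3.congr_deriv ?_
    have h4 := hode t ht
    simp only [Nat.add_sub_cancel, e1, id, Pi.pow_apply, Pi.mul_apply, mul_pow]
    push_cast
    linear_combination (((q : ℝ) + 1) * (t - 1) ^ q) * h4 + (t - 1) ^ (q + 1) * hc
  have hW0 : ∀ t ∈ Ici (1 : ℝ), W t = 0 := by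
    intro t ht
    have h1 : W t = W 1 := (convex_Ici (1 : ℝ)).is_const_of_fderivWithin_eq_zero (𝕜 := ℝ)
      (fun y hy => (hW y hy).differentiableWithinAt)
      (fun y hy => by
        rw [(hW y hy).hasFDerivWithinAt.fderivWithin (uniqueDiffOn_Ici 1 y hy)]
        ext; simp) ht (by simp)
    simpa [W] using h1
  -- The factor $(t-1)^p$ can be cancelled only for $t>1$; at $t=1$ the equation itself gives
  -- $u(1)^{2p}=1$.
  have key : t ^ (q + 1) * u t ^ (2 * (q + 1)) = 1 + a * (t - 1) := by
    rcases ht.eq_or_lt with rfl | ht'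
    · have h1 := hode 1 (by simp)
      norm_num at h1 ⊢
      exact h1
    · have h1 : (t - 1) ^ (q + 1) ≠ 0 := pow_ne_zero _ (by linarith)
      have h2 := hW0 t ht
      apply mul_left_cancel₀ h1
      simp only [W, mul_pow] at h2
      linear_combination h2
  have ht0 : 0 < t := by linarith
  have h1 : 0 ≤ 1 + a * (t - 1) := by nlinarith
  have hs : 0 ≤ radialSlope a (1 / (2 * (q + 1 : ℕ))) (t - 1) := by
    unfold radialSlope
    rw [add_sub_cancel]
    positivity
  refine (pow_left_inj₀ (hpos t ht).le hs (n := 2 * (q + 1)) (by omega)).1 ?_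
  unfold radialSlope
  rw [add_sub_cancel, mul_pow, ← Real.rpow_mul_natCast ht0.le, ← Real.rpow_mul_natCast h1]
  have e2 : (-1 / 2 : ℝ) * ((2 * (q + 1) : ℕ) : ℝ) = -((q + 1 : ℕ) : ℝ) := by push_cast; ring
  have e3 : 1 / (2 * ((q + 1 : ℕ) : ℝ)) * ((2 * (q + 1) : ℕ) : ℝ) = 1 := by
    push_cast; field_simp
  rw [e2, e3, Real.rpow_one, Real.rpow_neg ht0.le, Real.rpow_natCast, ← key]
  field_simp

/-- Near `1`, a profile is its value at `1` plus the primitive of its slope. -/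
theorem profile_eq_primitive {f : ℝ → ℝ} {a b : ℝ} (hf : ContDiffOn ℝ 2 f (Ici 1))
    (hfd : ∀ t : ℝ, 1 ≤ t → derivWithin f (Ici 1) t = radialSlope a b (t - 1)) {D : ℂ → ℂ}
    (hD0 : D 0 = 0) (hDx : ∀ x : ℝ, |x| < 1 → HasDerivAt D (radialSlope a b x) x) {t : ℝ}
    (ht1 : 1 ≤ t) (ht2 : t < 2) : f t = f 1 + (D ((t - 1 : ℝ) : ℂ)).re := by
  -- Right derivatives suffice for constancy and avoid a separate treatment of the endpoint $1$,
  -- where $f$ is controlled only from the right.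
  have hd : ∀ s ∈ Ico (1 : ℝ) 2, HasDerivWithinAt (fun s => f s - (D ((s - 1 : ℝ) : ℂ)).re) 0
      (Ici s) s := by
    intro s hs
    have h1 : HasDerivWithinAt f (derivWithin f (Ici 1) s) (Ici 1) s :=
      (hf.differentiableOn (by norm_num) s hs.1).hasDerivWithinAt
    have h2 := (hDx (s - 1) (by rw [abs_lt]; constructor <;> linarith [hs.1, hs.2])).real_of_complex
    have h3 := h2.comp s ((hasDerivAt_id s).sub_const 1)
    refine ((h1.mono (Ici_subset_Ici.2 hs.1)).sub h3.hasDerivWithinAt).congr_deriv ?_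
    simp [hfd s hs.1]
  have hcont : ContinuousOn (fun s => f s - (D ((s - 1 : ℝ) : ℂ)).re) (Icc 1 t) := by
    intro s hs
    refine ContinuousWithinAt.sub ((hf.continuousOn s hs.1).mono fun y hy => hy.1) ?_
    have h2 := (hDx (s - 1) (by
      rw [abs_lt]; constructor <;> linarith [hs.1, hs.2])).real_of_complex
    exact (h2.comp s ((hasDerivAt_id s).sub_const 1)).continuousAt.continuousWithinAt
  have h := constant_of_has_deriv_right_zero hcont
    (fun s hs => hd s ⟨hs.1, hs.2.trans ht2⟩) t ⟨ht1, le_rfl⟩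
  simp only [sub_self, Complex.ofReal_zero, hD0, Complex.zero_re, sub_zero] at h
  linarith

/-! ### Induced metrics restricted to a curve linear in a chart. -/

section Curve

variable {E₀ : Type*} [NormedAddCommGroup E₀] [NormedSpace ℂ E₀] [CompleteSpace E₀]
  {H : Type*} [TopologicalSpace H] {I : ModelWithCorners ℂ E₀ H}
  {M : Type*} [TopologicalSpace M] [ChartedSpace H M]

open Laplacian in
/-- The potential of an induced metric along a curve which is linear in a chart. -/
theorem IsKahlerImmersion.exists_norm_sq_eq_exp {E : Type*} [NormedAddCommGroup E]
    [InnerProductSpace ℂ E] [CompleteSpace E] {φ : M → ℝ} {Φ : M → CP E}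
    (hΦ : IsKahlerImmersion I (potentialMetric I φ) Φ) {c : ℂ → M} {v : E₀}
    (hchart : ∀ ζ, extChartAt I (c ζ) = extChartAt I (c 0))
    (hv : ∀ ζ, extChartAt I (c 0) (c ζ) = ζ • v)
    (hφ : ContDiffAt ℝ 2 (φ ∘ (extChartAt I (c 0)).symm) 0) :
    ∃ G : ℂ → WithLp 2 (ℂ × E), AnalyticAt ℂ G 0 ∧
      ∀ᶠ ζ in 𝓝 0, ‖G ζ‖ ^ 2 = Real.exp (φ (c ζ)) := by
  set e := extChartAt I (c 0)
  have hsrc : ∀ ζ, c ζ ∈ e.source := fun ζ => by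
    rw [← hchart ζ]; exact mem_extChartAt_source (c ζ)
  have hinv : ∀ ζ, e.symm (ζ • v) = c ζ := fun ζ => by
    rw [← hv ζ]; exact e.left_inv (hsrc ζ)
  have hcd : ∀ ζ, MDifferentiableAt 𝓘(ℂ, ℂ) I c ζ := by
    intro ζ
    rw [mdifferentiableAt_iff]
    constructor
    · have h1 : ContinuousAt e.symm (ζ • v) :=
        continuousAt_extChartAt_symm'' (by rw [← hv ζ]; exact e.map_source (hsrc ζ))
      have h2 : c = fun η => e.symm (η • v) := funext fun η => (hinv η).symm
      rw [h2]
      exact ContinuousAt.comp (f := fun η : ℂ => η • v) h1 (by fun_prop)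
    · have h3 : writtenInExtChartAt 𝓘(ℂ, ℂ) I ζ c = fun η : ℂ => η • v := by
        funext η
        change extChartAt I (c ζ) (c η) = _
        rw [hchart ζ, hv η]
      rw [h3]
      exact DifferentiableAt.differentiableWithinAt (by fun_prop)
  have hderiv : ∀ ζ : ℂ, deriv (fun η : ℂ => η • v) ζ = v := fun ζ => by
    simpa using ((hasDerivAt_id ζ).smul_const v).deriv
  have hcv : ∀ ζ, (mfderiv 𝓘(ℂ, ℂ) I c ζ (1 : ℂ) : E₀) = v := by
    intro ζ
    rw [mfderiv_curve_one (hcd ζ), hchart ζ]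
    have : (fun η => extChartAt I (c 0) (c η)) = fun η : ℂ => η • v := funext hv
    rw [this]
    exact hderiv ζ
  have hγ : ∀ ζ, MDifferentiableAt 𝓘(ℂ, ℂ) 𝓘(ℂ, ℂ →L[ℂ] E) (Φ ∘ c) ζ :=
    fun ζ => (hΦ.1 (c ζ)).comp ζ (hcd ζ)
  have hpull : ∀ ζ, (mfderiv 𝓘(ℂ, ℂ) 𝓘(ℂ, ℂ →L[ℂ] E) (Φ ∘ c) ζ (1 : ℂ) : ℂ →L[ℂ] E) =
      mfderiv I 𝓘(ℂ, ℂ →L[ℂ] E) Φ (c ζ) (mfderiv 𝓘(ℂ, ℂ) I c ζ (1 : ℂ)) := fun ζ => by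
    rw [mfderiv_comp ζ (hΦ.1 (c ζ)) (hcd ζ)]
    rfl
  obtain ⟨Z, hZ, hZ0, hlap⟩ := exists_lift_curve (γ := Φ ∘ c) (ζ := 0)
    (Filter.Eventually.of_forall hγ)
  have ht : Filter.Tendsto (fun ζ : ℂ => ζ • v) (𝓝 0) (𝓝 0) := by
    have : Continuous fun ζ : ℂ => ζ • v := by fun_prop
    simpa using this.tendsto 0
  have hlin : ∀ ζ : ℂ, AnalyticAt ℂ (fun η : ℂ => η • v) ζ := fun ζ =>
    (ContinuousLinearMap.toSpanSingleton ℂ v).analyticAt ζ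
  have hcomp : (fun ζ => φ (c ζ)) = (φ ∘ e.symm) ∘ fun ζ : ℂ => ζ • v := by
    funext ζ
    simp only [Function.comp_apply, hinv]
  refine _root_.exists_norm_sq_eq_exp hZ hZ0 (κ := fun ζ => φ (c ζ)) ?_ ?_
  · rw [hcomp]
    refine ContDiffAt.comp (0 : ℂ) (by simpa using hφ) ?_
    exact ((hlin 0).contDiffAt (n := 2)).restrict_scalars ℝ
  · filter_upwards [hlap, ht.eventually (hφ.eventually (by norm_num))] with ζ h1 h2
    have h3 := hΦ.2 (c ζ) (mfderiv 𝓘(ℂ, ℂ) I c ζ (1 : ℂ)) (mfderiv 𝓘(ℂ, ℂ) I c ζ (1 : ℂ))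
    rw [← hpull] at h3
    -- `potentialMetric` uses the preferred chart of each point. Since that chart is constant along
    -- the curve, all its values there are Levi forms of one function in the one direction $v$.
    have h4 : potentialMetric I φ (c ζ) (mfderiv 𝓘(ℂ, ℂ) I c ζ (1 : ℂ))
        (mfderiv 𝓘(ℂ, ℂ) I c ζ (1 : ℂ)) = leviForm (φ ∘ e.symm) (ζ • v) v v := by
      change leviForm (E := E₀) (φ ∘ (extChartAt I (c ζ)).symm) (extChartAt I (c ζ) (c ζ))
        (mfderiv 𝓘(ℂ, ℂ) I c ζ (1 : ℂ) : E₀) (mfderiv 𝓘(ℂ, ℂ) I c ζ (1 : ℂ) : E₀) = _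
      rw [hcv ζ, hchart ζ, hv ζ]
    have h5 := leviForm_comp_holomorphic (hlin ζ) h2
    rw [hderiv ζ, ← hcomp, leviForm_one_one_re, ← h4, ← h3] at h5
    have h7 : 1 / 4 * (Δ fun η => Real.log (‖Z η‖ ^ 2)) ζ = 1 / 4 * (Δ fun ζ => φ (c ζ)) ζ :=
      h1.symm.trans h5.symm
    linarith

/-- A metric whose potential, along a curve which is linear in a chart, is the radial potential
with derivative `radialSlope a b`, is not projectively induced. -/
theorem not_isProjectivelyInduced_of_curve {a b : ℝ} (ha0 : 0 ≤ a) (ha1 : a < 1) (hb : 0 ≤ b)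
    {D : ℂ → ℂ} (hD0 : D 0 = 0) (hD : DifferentiableOn ℂ D (Metric.ball 0 1))
    (hDx : ∀ x : ℝ, |x| < 1 → HasDerivAt D (radialSlope a b x) x)
    (hDr : ∀ x : ℝ, |x| < 1 → D x = ((D x).re : ℂ)) {φ : M → ℝ} {c : ℂ → M} {v : E₀}
    (hchart : ∀ ζ, extChartAt I (c ζ) = extChartAt I (c 0))
    (hv : ∀ ζ, extChartAt I (c 0) (c ζ) = ζ • v)
    (hφ : ContDiffAt ℝ 2 (φ ∘ (extChartAt I (c 0)).symm) 0) {C : ℝ}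
    (hφc : ∀ᶠ ζ in 𝓝 (0 : ℂ), φ (c ζ) = C + (D ((‖ζ‖ ^ 2 : ℝ) : ℂ)).re) :
    ¬ IsProjectivelyInduced I (potentialMetric I φ) := by
  have key : ∀ (E : Type) [NormedAddCommGroup E] [InnerProductSpace ℂ E] [CompleteSpace E]
      (Φ : M → CP E), ¬ IsKahlerImmersion I (potentialMetric I φ) Φ := by
    intro E _ _ _ Φ hΦ
    obtain ⟨G, hG, hnorm⟩ := hΦ.exists_norm_sq_eq_exp hchart hv hφ
    -- The factor $e^{-C/2}$ normalises the potential to vanish at $\zeta=0$, matching $D(0)=0$.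
    refine not_norm_sq_eq_exp_primitive ha0 ha1 hb hD0 hD hDx hDr
      (G := fun ζ => (Real.exp (-C / 2) : ℂ) • G ζ) (analyticAt_const.fun_smul hG) ?_
    filter_upwards [hnorm, hφc] with ζ h1 h2
    rw [norm_smul, mul_pow, h1, h2, Complex.norm_real, Real.norm_of_nonneg (Real.exp_nonneg _),
      ← Real.exp_nat_mul, ← Real.exp_add]
    congr 1
    push_cast
    ring
  rintro (⟨N, Φ, hΦ⟩ | ⟨Φ, hΦ⟩)
  · exact key _ Φ hΦ
  · exact key _ Φ hΦ

end Curve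

/-- The base point lies where $\mathcal N$ takes its minimum $1$, the endpoint of the domain on
which $f$ is regular. Smoothness there comes from replacing $f$ by $f(1)+\operatorname{Re}
D(\cdot-1)$, which extends smoothly across $1$ and agrees with $f$ on the values that $\mathcal N$
takes nearby. -/
theorem contDiffAt_radial_comp {E₀ : Type*} [NormedAddCommGroup E₀] [NormedSpace ℝ E₀]
    {f : ℝ → ℝ} {D : ℂ → ℂ} (hD : DifferentiableOn ℂ D (Metric.ball 0 1))
    (hf : ∀ t : ℝ, 1 ≤ t → t < 2 → f t = f 1 + (D ((t - 1 : ℝ) : ℂ)).re) {φ N : E₀ → ℝ} {p : E₀}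
    (hN : ContDiffAt ℝ 2 N p) (hNp : N p = 1) (hφ : ∀ᶠ q in 𝓝 p, φ q = f (N q))
    (hN1 : ∀ᶠ q in 𝓝 p, 1 ≤ N q) : ContDiffAt ℝ 2 φ p := by
  have h1 : ContDiffAt ℝ 2 (fun x : ℝ => (D x).re) 0 := by
    have h2 : ContDiffAt ℂ 2 D 0 := (hD.analyticAt (Metric.ball_mem_nhds 0 one_pos)).contDiffAt
    have h3 : ContDiffAt ℝ 2 D ((0 : ℝ) : ℂ) := by simpa using h2.restrict_scalars ℝ
    exact Complex.reCLM.contDiff.contDiffAt.comp 0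
      (h3.comp 0 Complex.ofRealCLM.contDiff.contDiffAt)
  have h4 : ContDiffAt ℝ 2 (fun q => f 1 + (D ((N q - 1 : ℝ) : ℂ)).re) p := by
    refine contDiffAt_const.add (ContDiffAt.comp p (g := fun x : ℝ => (D x).re) ?_
      (hN.sub contDiffAt_const))
    simpa [hNp] using h1
  refine h4.congr_of_eventuallyEq ?_
  have h5 : ∀ᶠ q in 𝓝 p, N q < 2 := hN.continuousAt.eventually (gt_mem_nhds (by rw [hNp]; norm_num))
  filter_upwards [hφ, hN1, h5] with q h6 h7 h8
  rw [h6, hf _ h7 h8]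

/-! ### The standard chart of the Grassmannian. -/

namespace Gr

variable {F E : Type*} [NormedAddCommGroup F] [InnerProductSpace ℂ F]
  [NormedAddCommGroup E] [InnerProductSpace ℂ E] [FiniteDimensional ℂ F]

theorem frameAt_ofGraph_stdFrame (T : F →L[ℂ] E) :
    frameAt (ofGraph (stdFrame F E) T) = stdFrame F E :=
  if_pos ⟨T, rfl⟩

theorem chartAt_eq_of_frameAt_eq {V W : Gr F E} (h : frameAt V = frameAt W) :
    chartAt (F →L[ℂ] E) V = chartAt (F →L[ℂ] E) W := by
  -- The charts carry proofs of atlas membership that depend on the frame, so the frames are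
  -- generalised before substituting.
  have : ∀ L L' : Frame F E, L = L' → ∀ (hL : graphChart L ∈ (core F E).atlas)
      (hL' : graphChart L' ∈ (core F E).atlas),
      (core F E).openPartialHomeomorph (graphChart L) hL =
        (core F E).openPartialHomeomorph (graphChart L') hL' := by
    rintro L _ rfl _ _
    rfl
  exact this _ _ h _ _

theorem chartAt_ofGraph_stdFrame (T S : F →L[ℂ] E) :
    chartAt (F →L[ℂ] E) (ofGraph (stdFrame F E) T) (ofGraph (stdFrame F E) S) = S := by
  have h : chartAt (F →L[ℂ] E) (ofGraph (stdFrame F E) T) (ofGraph (stdFrame F E) S) =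
      graphChart (frameAt (ofGraph (stdFrame F E) T)) (ofGraph (stdFrame F E) S) := rfl
  rw [h, frameAt_ofGraph_stdFrame, graphChart_ofGraph]

theorem chartAt_symm_stdFrame (T S : F →L[ℂ] E) :
    (chartAt (F →L[ℂ] E) (ofGraph (stdFrame F E) T)).symm S = ofGraph (stdFrame F E) S := by
  have h : (chartAt (F →L[ℂ] E) (ofGraph (stdFrame F E) T)).symm S =
      ofGraph (frameAt (ofGraph (stdFrame F E) T)) S := rfl
  rw [h, frameAt_ofGraph_stdFrame]

end Gr

theorem TopologicalSpace.Opens.chartAt_eq_of_eq {H M : Type*} [TopologicalSpace H]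
    [TopologicalSpace M] [ChartedSpace H M] {U : TopologicalSpace.Opens M} {x y : U}
    (h : chartAt H x.1 = chartAt H y.1) : chartAt H x = chartAt H y := by
  rw [TopologicalSpace.Opens.chartAt_eq, TopologicalSpace.Opens.chartAt_eq, h]

/-! ### Case II. -/

namespace MII

/-- The homogeneous coordinates of the line with inhomogeneous coordinates `T`. -/
noncomputable def vec {n : ℕ} (T : ℂ →L[ℂ] EuclideanSpace ℂ (Fin n)) : Hom n :=
  Gr.stdFrame ℂ (EuclideanSpace ℂ (Fin n)) (1, T 1)

theorem vec_mem {n : ℕ} (T : ℂ →L[ℂ] EuclideanSpace ℂ (Fin n)) :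
    vec T ∈ (Gr.ofGraph (Gr.stdFrame ℂ (EuclideanSpace ℂ (Fin n))) T).carrier := ⟨1, rfl⟩

theorem pairing_vec {n : ℕ} (T S : ℂ →L[ℂ] EuclideanSpace ℂ (Fin n)) :
    pairing (vec T) (vec S) = 1 + ∑ j, T 1 j * S 1 j := by
  simp [pairing, vec, Gr.stdFrame]

theorem norm_vec_sq {n : ℕ} (T : ℂ →L[ℂ] EuclideanSpace ℂ (Fin n)) :
    ‖vec T‖ ^ 2 = 1 + ‖T 1‖ ^ 2 := by
  rw [WithLp.prod_norm_sq_eq_of_L2]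
  simp [vec, Gr.stdFrame]

/-- The pairing is the Hermitian product of $\bar z$ with $w$, so this is Cauchy-Schwarz; it yields
$\mathcal N\ge1$. -/
theorem norm_pairing_le {n : ℕ} (z w : Hom n) : ‖pairing z w‖ ≤ ‖z‖ * ‖w‖ := by
  set y : Hom n := WithLp.toLp 2 (starRingEnd ℂ z.fst,
    WithLp.toLp 2 fun j => starRingEnd ℂ (z.snd j))
  have h1 : pairing z w = inner ℂ y w := by
    rw [WithLp.prod_inner_apply, PiLp.inner_apply]
    simp [pairing, y, mul_comm]
  have h2 : ‖y‖ = ‖z‖ := by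
    rw [← sq_eq_sq₀ (norm_nonneg _) (norm_nonneg _), WithLp.prod_norm_sq_eq_of_L2,
      WithLp.prod_norm_sq_eq_of_L2, EuclideanSpace.norm_sq_eq, EuclideanSpace.norm_sq_eq]
    simp [y]
  rw [h1, ← h2]
  exact norm_inner_le_norm _ _

theorem one_le_normFn {n : ℕ} (p : space n) : 1 ≤ normFn p := by
  obtain ⟨⟨z, w⟩, hz, hw, h⟩ := exists_rep p
  rw [normFn_eq p z w hz hw h, one_le_div (by positivity), ← mul_pow]
  exact pow_le_pow_left₀ (norm_nonneg _) (norm_pairing_le z w) 2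

/-- `𝒩` in the standard inhomogeneous coordinates. -/
noncomputable def coordNorm {n : ℕ} (q : (ℂ →L[ℂ] EuclideanSpace ℂ (Fin n)) ×
    (ℂ →L[ℂ] EuclideanSpace ℂ (Fin n))) : ℝ :=
  (1 + ‖q.1 1‖ ^ 2) * (1 + ‖q.2 1‖ ^ 2) / ‖1 + ∑ j, q.1 1 j * q.2 1 j‖ ^ 2

theorem contDiffAt_coordNorm (n : ℕ) : ContDiffAt ℝ 2 (coordNorm (n := n)) 0 := by
  have h1 : ContDiff ℂ 2 fun q : (ℂ →L[ℂ] EuclideanSpace ℂ (Fin n)) ×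
      (ℂ →L[ℂ] EuclideanSpace ℂ (Fin n)) => q.1 1 := contDiff_fst.clm_apply contDiff_const
  have h2 : ContDiff ℂ 2 fun q : (ℂ →L[ℂ] EuclideanSpace ℂ (Fin n)) ×
      (ℂ →L[ℂ] EuclideanSpace ℂ (Fin n)) => q.2 1 := contDiff_snd.clm_apply contDiff_const
  have h3 : ContDiff ℂ 2 fun q : (ℂ →L[ℂ] EuclideanSpace ℂ (Fin n)) ×
      (ℂ →L[ℂ] EuclideanSpace ℂ (Fin n)) => 1 + ∑ j, q.1 1 j * q.2 1 j := by
    refine contDiff_const.add (ContDiff.sum fun j _ => ?_)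
    exact ((EuclideanSpace.proj j : EuclideanSpace ℂ (Fin n) →L[ℂ] ℂ).contDiff.comp h1).mul
      ((EuclideanSpace.proj j : EuclideanSpace ℂ (Fin n) →L[ℂ] ℂ).contDiff.comp h2)
  refine ContDiffAt.div ?_ ((h3.restrict_scalars ℝ).norm_sq ℂ).contDiffAt (by simp)
  exact ((contDiff_const.add ((h1.restrict_scalars ℝ).norm_sq ℂ)).mul
    (contDiff_const.add ((h2.restrict_scalars ℝ).norm_sq ℂ))).contDiffAt

theorem normFn_eq_coordNorm {n : ℕ} (p : space n) {T S : ℂ →L[ℂ] EuclideanSpace ℂ (Fin n)}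
    (hp : p.1 = (Gr.ofGraph (Gr.stdFrame ℂ (EuclideanSpace ℂ (Fin n))) T,
      Gr.ofGraph (Gr.stdFrame ℂ (EuclideanSpace ℂ (Fin n))) S))
    (h : 1 + ∑ j, T 1 j * S 1 j ≠ 0) : normFn p = coordNorm (T, S) := by
  rw [normFn_eq p (vec T) (vec S) (by rw [hp]; exact vec_mem T) (by rw [hp]; exact vec_mem S)
    (by rwa [pairing_vec]), norm_vec_sq, norm_vec_sq, pairing_vec]
  rfl

/-- The direction of the curve `ζ ↦ ([1 : ζ : 0 : ⋯ : 0], [1 : 0 : ⋯ : 0])`. -/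
noncomputable def direction (n : ℕ) (hn : 1 ≤ n) : ℂ →L[ℂ] EuclideanSpace ℂ (Fin n) :=
  ContinuousLinearMap.toSpanSingleton ℂ (EuclideanSpace.single (⟨0, hn⟩ : Fin n) (1 : ℂ))

/-- The curve `ζ ↦ ([1 : ζ : 0 : ⋯ : 0], [1 : 0 : ⋯ : 0])`. -/
noncomputable def curve (n : ℕ) (hn : 1 ≤ n) (ζ : ℂ) : space n :=
  ⟨(Gr.ofGraph (Gr.stdFrame ℂ (EuclideanSpace ℂ (Fin n))) (ζ • direction n hn),
    Gr.ofGraph (Gr.stdFrame ℂ (EuclideanSpace ℂ (Fin n))) 0), fun h => by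
      have := h _ (vec_mem _) _ (vec_mem _)
      rw [pairing_vec] at this
      simp at this⟩

theorem normFn_curve (n : ℕ) (hn : 1 ≤ n) (ζ : ℂ) : normFn (curve n hn ζ) = 1 + ‖ζ‖ ^ 2 := by
  rw [normFn_eq_coordNorm (curve n hn ζ) rfl (by simp)]
  simp [coordNorm, direction, norm_smul]

/-- The curve stays in the standard affine coordinates, and `frameAt` prefers the standard frame
wherever it applies. -/
theorem chartAt_curve (n : ℕ) (hn : 1 ≤ n) (ζ : ℂ) :
    chartAt (ModelProd (ℂ →L[ℂ] EuclideanSpace ℂ (Fin n)) (ℂ →L[ℂ] EuclideanSpace ℂ (Fin n)))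
      (curve n hn ζ) = chartAt _ (curve n hn 0) := by
  apply TopologicalSpace.Opens.chartAt_eq_of_eq
  simp only [prodChartedSpace_chartAt, curve]
  rw [Gr.chartAt_eq_of_frameAt_eq ((Gr.frameAt_ofGraph_stdFrame (ζ • direction n hn)).trans
    (Gr.frameAt_ofGraph_stdFrame ((0 : ℂ) • direction n hn)).symm)]

theorem extChartAt_curve (n : ℕ) (hn : 1 ≤ n) (ζ : ℂ) :
    extChartAt (model n) (curve n hn 0) (curve n hn ζ) =
      ((ζ • direction n hn, 0) : (ℂ →L[ℂ] EuclideanSpace ℂ (Fin n)) ×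
        (ℂ →L[ℂ] EuclideanSpace ℂ (Fin n))) := by
  have h : extChartAt (model n) (curve n hn 0) (curve n hn ζ) =
    (chartAt (ℂ →L[ℂ] EuclideanSpace ℂ (Fin n)) (curve n hn 0).1.1 (curve n hn ζ).1.1,
      chartAt (ℂ →L[ℂ] EuclideanSpace ℂ (Fin n)) (curve n hn 0).1.2 (curve n hn ζ).1.2) := rfl
  rw [h]
  simp only [curve]
  rw [Gr.chartAt_ofGraph_stdFrame, Gr.chartAt_ofGraph_stdFrame]

/-- The statement is local because the inverse chart of an open submanifold is meaningful only on
its target. -/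
theorem val_extChartAt_symm_curve (n : ℕ) (hn : 1 ≤ n) :
    ∀ᶠ q in 𝓝 (0 : (ℂ →L[ℂ] EuclideanSpace ℂ (Fin n)) × (ℂ →L[ℂ] EuclideanSpace ℂ (Fin n))),
      ((extChartAt (model n) (curve n hn 0)).symm q).1 =
        (Gr.ofGraph (Gr.stdFrame ℂ (EuclideanSpace ℂ (Fin n))) q.1,
          Gr.ofGraph (Gr.stdFrame ℂ (EuclideanSpace ℂ (Fin n))) q.2) := by
  have h := TopologicalSpace.Opens.chartAt_subtype_val_symm_eventuallyEq (space n)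
    (H := ModelProd (ℂ →L[ℂ] EuclideanSpace ℂ (Fin n)) (ℂ →L[ℂ] EuclideanSpace ℂ (Fin n)))
    (x := curve n hn 0)
  have h0 : chartAt (ModelProd (ℂ →L[ℂ] EuclideanSpace ℂ (Fin n))
      (ℂ →L[ℂ] EuclideanSpace ℂ (Fin n))) (curve n hn 0).1 (curve n hn 0).1 =
      (0 : (ℂ →L[ℂ] EuclideanSpace ℂ (Fin n)) × (ℂ →L[ℂ] EuclideanSpace ℂ (Fin n))) :=
    (extChartAt_curve n hn 0).trans (Prod.ext (zero_smul ℂ (direction n hn)) rfl)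
  rw [h0] at h
  filter_upwards [h] with q hq
  refine hq.symm.trans ?_
  change ((chartAt (ℂ →L[ℂ] EuclideanSpace ℂ (Fin n)) (curve n hn 0).1.1).symm q.1,
    (chartAt (ℂ →L[ℂ] EuclideanSpace ℂ (Fin n)) (curve n hn 0).1.2).symm q.2) = _
  simp only [curve]
  rw [Gr.chartAt_symm_stdFrame, Gr.chartAt_symm_stdFrame]

/-- Here $p=n$ and the right side of the equation is constant, so $c=a=0$: the slope is $t^{-1/2}$
and $f(t)=f(1)+2(\sqrt t-1)$. -/
theorem metric_not_isProjectivelyInduced (n : ℕ) (hn : 1 ≤ n) {f : ℝ → ℝ} (hf : IsProfile n f) :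
    ¬ IsProjectivelyInduced (model n) (metric n f) := by
  obtain ⟨D, hD0, hD, hDx, hDr⟩ :=
    exists_primitive_radialSlope (le_refl (0 : ℝ)) one_pos (1 / (2 * (n : ℝ)))
  have hu : DifferentiableOn ℝ (derivWithin f (Ici 1)) (Ici 1) :=
    (hf.contDiffOn.derivWithin (uniqueDiffOn_Ici 1) (m := 1) (by norm_num)).differentiableOn
      (by norm_num)
  have hrad : ∀ t : ℝ, 1 ≤ t → t < 2 → f t = f 1 + (D ((t - 1 : ℝ) : ℂ)).re := fun t h1 h2 =>
    profile_eq_primitive hf.contDiffOn (fun t ht => eq_radialSlope_of_ode hn le_rfl (c := 0)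
      (by simp) hu hf.deriv_pos (fun t ht => by rw [hf.ode t ht]; ring) ht) hD0 hDx h1 h2
  refine not_isProjectivelyInduced_of_curve le_rfl one_pos (by positivity) hD0 hD hDx hDr
    (c := curve n hn) (v := (direction n hn, 0)) (C := f 1) (fun ζ => ?_)
    (fun ζ => (extChartAt_curve n hn ζ).trans (Prod.ext rfl (smul_zero (A := ℂ →L[ℂ] EuclideanSpace ℂ (Fin n)) ζ).symm))
    ?_ ?_
  · simp only [extChartAt, chartAt_curve n hn ζ]
  · have hne : ∀ᶠ q in 𝓝 (0 : (ℂ →L[ℂ] EuclideanSpace ℂ (Fin n)) ×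
        (ℂ →L[ℂ] EuclideanSpace ℂ (Fin n))), 1 + ∑ j, q.1 1 j * q.2 1 j ≠ 0 := by
      refine ContinuousAt.eventually_ne (Continuous.continuousAt ?_) (by simp)
      fun_prop
    refine contDiffAt_radial_comp hD hrad (contDiffAt_coordNorm n) (by simp [coordNorm]) ?_ ?_
    · filter_upwards [hne, val_extChartAt_symm_curve n hn] with q h1 h2
      simp only [Function.comp_apply]
      rw [normFn_eq_coordNorm _ h2 h1]
    · filter_upwards [hne, val_extChartAt_symm_curve n hn] with q h1 h2
      rw [← normFn_eq_coordNorm _ h2 h1]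
      exact one_le_normFn _
  · have hc : ∀ᶠ ζ in 𝓝 (0 : ℂ), 1 + ‖ζ‖ ^ 2 < 2 := by
      have : Continuous fun ζ : ℂ => 1 + ‖ζ‖ ^ 2 := by fun_prop
      exact this.continuousAt.eventually (gt_mem_nhds (by norm_num))
    filter_upwards [hc] with ζ h1
    rw [normFn_curve, hrad _ (by linarith [sq_nonneg ‖ζ‖]) h1, add_sub_cancel_left]

end MII

/-! ### Case III. -/

/-- Groups the coordinates into the pairs on which $\omega$ is built. -/
theorem sum_fin_two_mul {A : Type*} [AddCommMonoid A] (n : ℕ) (g : Fin (2 * n) → A) :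
    ∑ k, g k = ∑ j : Fin n, (g ⟨2 * j, by omega⟩ + g ⟨2 * j + 1, by omega⟩) := by
  induction n with
  | zero => simp
  | succ n ih =>
    have h : ∑ k, g k = ∑ k : Fin (2 * n + 1 + 1), g k := rfl
    rw [h, Fin.sum_univ_castSucc, Fin.sum_univ_castSucc, Fin.sum_univ_castSucc, add_assoc]
    congr 1
    exact ih fun k => g (k.castSucc.castSucc)

/-- Bessel's inequality for a vector orthogonal to `z`, of the same length as `z`. -/
theorem norm_inner_sq_le_gram {V : Type*} [NormedAddCommGroup V] [InnerProductSpace ℂ V]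
    {y z : V} (w : V) (hyz : inner ℂ y z = 0) (hn : ‖y‖ = ‖z‖) :
    ‖inner ℂ y w‖ ^ 2 ≤ ‖z‖ ^ 2 * ‖w‖ ^ 2 - ‖inner ℂ z w‖ ^ 2 := by
  rcases eq_or_ne z 0 with rfl | hz
  · have : y = 0 := by simpa using hn
    simp [this]
  have hz0 : 0 < ‖z‖ := norm_pos_iff.2 hz
  have hon : Orthonormal ℂ ![((‖z‖ : ℂ)⁻¹) • z, ((‖z‖ : ℂ)⁻¹) • y] := by
    have hzy : inner ℂ z y = 0 := by rw [← inner_conj_symm, hyz, map_zero]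
    constructor
    · intro i
      fin_cases i <;> simp [norm_smul, hn, hz0.ne']
    · intro i j hij
      fin_cases i <;> fin_cases j <;> simp [inner_smul_left, inner_smul_right, hyz, hzy] at hij ⊢
  have hb := hon.sum_inner_products_le w (s := Finset.univ)
  rw [Fin.sum_univ_two] at hb
  simp only [Matrix.cons_val_zero, Matrix.cons_val_one, inner_smul_left, norm_mul, mul_pow,
    map_inv₀, Complex.conj_ofReal, norm_inv, Complex.norm_real, norm_norm] at hb
  have h2 : ‖z‖ ^ 2 * ((‖z‖⁻¹) ^ 2 * ‖inner ℂ z w‖ ^ 2 + (‖z‖⁻¹) ^ 2 * ‖inner ℂ y w‖ ^ 2) ≤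
      ‖z‖ ^ 2 * ‖w‖ ^ 2 := mul_le_mul_of_nonneg_left hb (by positivity)
  have h3 : ‖z‖ ^ 2 * ((‖z‖⁻¹) ^ 2 * ‖inner ℂ z w‖ ^ 2 + (‖z‖⁻¹) ^ 2 * ‖inner ℂ y w‖ ^ 2) =
      ‖inner ℂ z w‖ ^ 2 + ‖inner ℂ y w‖ ^ 2 := by
    field_simp
  linarith

namespace MIII

/-- Writing $\omega(z,w)=\langle y,w\rangle$, the vector $y$ consists of the conjugated coordinates
of $z$, swapped within each pair with one sign changed. Thus $\|y\|=\|z\|$, and $y\perp z$ because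
$\omega$ is alternating, so Bessel's inequality applies; it yields $\mathcal N\ge1$. -/
theorem norm_symp_sq_le {n : ℕ} (z w : Hom n) :
    ‖symp z w‖ ^ 2 ≤ ‖z‖ ^ 2 * ‖w‖ ^ 2 - ‖inner ℂ z w‖ ^ 2 := by
  set y : Hom n := WithLp.toLp 2 (!₂[starRingEnd ℂ (z.fst 1), -starRingEnd ℂ (z.fst 0)],
    WithLp.toLp 2 fun k : Fin (2 * n) =>
      if h : k.1 % 2 = 0 then starRingEnd ℂ (z.snd ⟨k + 1, by omega⟩)
      else -starRingEnd ℂ (z.snd ⟨k - 1, by omega⟩))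
  have heven : ∀ j : Fin n, y.snd ⟨2 * j, by omega⟩ = starRingEnd ℂ (z.snd ⟨2 * j + 1, by omega⟩) :=
    fun j => dif_pos (Nat.mul_mod_right 2 j)
  have hodd : ∀ j : Fin n, y.snd ⟨2 * j + 1, by omega⟩ = -starRingEnd ℂ (z.snd ⟨2 * j, by omega⟩) :=
    fun j => dif_neg (show ¬ (2 * j.1 + 1) % 2 = 0 by omega)
  have hfst0 : y.fst 0 = starRingEnd ℂ (z.fst 1) := rfl
  have hfst1 : y.fst 1 = -starRingEnd ℂ (z.fst 0) := rfl
  clear_value y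
  have h1 : ∀ w, inner ℂ y w = symp z w := by
    intro w
    have hprod : inner ℂ y w = inner ℂ y.fst w.fst + inner ℂ y.snd w.snd :=
      WithLp.prod_inner_apply y w
    rw [hprod, PiLp.inner_apply, PiLp.inner_apply, sum_fin_two_mul, Fin.sum_univ_two, add_comm]
    simp only [symp, RCLike.inner_apply, heven, hodd, hfst0, hfst1, map_neg, Complex.conj_conj]
    congr 1
    · exact Finset.sum_congr rfl fun j _ => by ring
    · ring
  have h2 : ‖y‖ = ‖z‖ := by
    rw [← sq_eq_sq₀ (norm_nonneg _) (norm_nonneg _), WithLp.prod_norm_sq_eq_of_L2,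
      WithLp.prod_norm_sq_eq_of_L2, EuclideanSpace.norm_sq_eq, EuclideanSpace.norm_sq_eq,
      EuclideanSpace.norm_sq_eq, EuclideanSpace.norm_sq_eq, sum_fin_two_mul, sum_fin_two_mul,
      Fin.sum_univ_two, Fin.sum_univ_two]
    simp only [heven, hodd, hfst0, hfst1, norm_neg, RCLike.norm_conj]
    congr 1
    · exact add_comm _ _
    · exact Finset.sum_congr rfl fun j _ => add_comm _ _
  have h3 : symp z z = 0 := by
    simp only [symp]
    rw [Finset.sum_eq_zero fun j _ => by ring]
    ring
  rw [← h1]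
  exact norm_inner_sq_le_gram w ((h1 z).trans h3) h2

theorem one_le_normFn {n : ℕ} (p : space n) : 1 ≤ normFn p := by
  obtain ⟨⟨z, w⟩, hz, hw, h⟩ := exists_rep p
  rw [normFn_eq p z w hz hw h, ratio, one_le_div (by positivity)]
  exact norm_symp_sq_le z w

/-- The `i`-th basis vector of the plane with inhomogeneous coordinates `T`. -/
noncomputable def vec {n : ℕ} (i : Fin 2)
    (T : EuclideanSpace ℂ (Fin 2) →L[ℂ] EuclideanSpace ℂ (Fin (2 * n))) : Hom n :=
  Gr.stdFrame (EuclideanSpace ℂ (Fin 2)) (EuclideanSpace ℂ (Fin (2 * n)))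
    (EuclideanSpace.single i 1, T (EuclideanSpace.single i 1))

theorem vec_mem {n : ℕ} (i : Fin 2)
    (T : EuclideanSpace ℂ (Fin 2) →L[ℂ] EuclideanSpace ℂ (Fin (2 * n))) :
    vec i T ∈ (Gr.ofGraph (Gr.stdFrame (EuclideanSpace ℂ (Fin 2))
      (EuclideanSpace ℂ (Fin (2 * n)))) T).carrier := ⟨EuclideanSpace.single i 1, rfl⟩

theorem contDiff_vec {n : ℕ} (i : Fin 2) : ContDiff ℂ 2 (vec (n := n) i) :=
  (Gr.stdFrame (EuclideanSpace ℂ (Fin 2)) (EuclideanSpace ℂ (Fin (2 * n)))).contDiff.comp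
    (contDiff_const.prodMk (contDiff_id.clm_apply contDiff_const))

theorem symp_vec {n : ℕ} (T : EuclideanSpace ℂ (Fin 2) →L[ℂ] EuclideanSpace ℂ (Fin (2 * n))) :
    symp (vec 0 T) (vec 1 T) = (∑ j : Fin n,
      (T (EuclideanSpace.single 0 1) ⟨2 * j + 1, by omega⟩ *
          T (EuclideanSpace.single 1 1) ⟨2 * j, by omega⟩ -
        T (EuclideanSpace.single 0 1) ⟨2 * j, by omega⟩ *
          T (EuclideanSpace.single 1 1) ⟨2 * j + 1, by omega⟩)) - 1 := by
  simp [symp, vec, Gr.stdFrame, sub_eq_add_neg]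

theorem contDiff_symp_vec (n : ℕ) :
    ContDiff ℂ 2 fun T : EuclideanSpace ℂ (Fin 2) →L[ℂ] EuclideanSpace ℂ (Fin (2 * n)) =>
      symp (vec 0 T) (vec 1 T) := by
  have h : ∀ (i : Fin 2) (k : Fin (2 * n)), ContDiff ℂ 2
      fun T : EuclideanSpace ℂ (Fin 2) →L[ℂ] EuclideanSpace ℂ (Fin (2 * n)) =>
        T (EuclideanSpace.single i 1) k := fun i k =>
    (EuclideanSpace.proj k : EuclideanSpace ℂ (Fin (2 * n)) →L[ℂ] ℂ).contDiff.comp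
      (contDiff_id.clm_apply contDiff_const)
  have hsum : ContDiff ℂ 2
      fun T : EuclideanSpace ℂ (Fin 2) →L[ℂ] EuclideanSpace ℂ (Fin (2 * n)) => ∑ j : Fin n,
        (T (EuclideanSpace.single 0 1) ⟨2 * j + 1, by omega⟩ *
            T (EuclideanSpace.single 1 1) ⟨2 * j, by omega⟩ -
          T (EuclideanSpace.single 0 1) ⟨2 * j, by omega⟩ *
            T (EuclideanSpace.single 1 1) ⟨2 * j + 1, by omega⟩) := by
    refine ContDiff.sum fun j _ => ?_
    exact ((h 0 ⟨2 * j + 1, by omega⟩).mul (h 1 ⟨2 * j, by omega⟩)).sub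
      ((h 0 ⟨2 * j, by omega⟩).mul (h 1 ⟨2 * j + 1, by omega⟩))
  rw [funext symp_vec]
  exact hsum.sub contDiff_const

theorem symp_vec_zero (n : ℕ) :
    symp (vec 0 (0 : EuclideanSpace ℂ (Fin 2) →L[ℂ] EuclideanSpace ℂ (Fin (2 * n)))) (vec 1 0) =
      -1 := by
  simp [symp_vec]

/-- `𝒩` in the standard inhomogeneous coordinates. -/
noncomputable def coordNorm {n : ℕ}
    (T : EuclideanSpace ℂ (Fin 2) →L[ℂ] EuclideanSpace ℂ (Fin (2 * n))) : ℝ :=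
  ratio (vec 0 T) (vec 1 T)

theorem contDiffAt_coordNorm (n : ℕ) : ContDiffAt ℝ 2 (coordNorm (n := n)) 0 := by
  have h : ∀ i, ContDiff ℝ 2 (vec (n := n) i) := fun i => (contDiff_vec i).restrict_scalars ℝ
  refine ContDiffAt.div (ContDiff.contDiffAt ?_)
    (((contDiff_symp_vec n).restrict_scalars ℝ).norm_sq ℂ).contDiffAt ?_
  · exact (((h 0).norm_sq ℂ).mul ((h 1).norm_sq ℂ)).sub (((h 0).inner ℂ (h 1)).norm_sq ℂ)
  · rw [symp_vec_zero]
    simp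

theorem normFn_eq_coordNorm {n : ℕ} (p : space n)
    {T : EuclideanSpace ℂ (Fin 2) →L[ℂ] EuclideanSpace ℂ (Fin (2 * n))}
    (hp : p.1 = Gr.ofGraph (Gr.stdFrame (EuclideanSpace ℂ (Fin 2))
      (EuclideanSpace ℂ (Fin (2 * n)))) T)
    (h : symp (vec 0 T) (vec 1 T) ≠ 0) : normFn p = coordNorm T :=
  normFn_eq p (vec 0 T) (vec 1 T) (by rw [hp]; exact vec_mem 0 T) (by rw [hp]; exact vec_mem 1 T) h

/-- The direction of the curve of planes spanned by `(ζ, 0, …, 0, 1, 0)` and `(0, …, 0, 0, 1)`. -/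
noncomputable def direction (n : ℕ) (hn : 1 ≤ n) :
    EuclideanSpace ℂ (Fin 2) →L[ℂ] EuclideanSpace ℂ (Fin (2 * n)) :=
  (EuclideanSpace.proj 0 : EuclideanSpace ℂ (Fin 2) →L[ℂ] ℂ).smulRight
    (EuclideanSpace.single (⟨0, by omega⟩ : Fin (2 * n)) (1 : ℂ))

theorem symp_vec_direction (n : ℕ) (hn : 1 ≤ n) (ζ : ℂ) :
    symp (vec 0 (ζ • direction n hn)) (vec 1 (ζ • direction n hn)) = -1 := by
  simp [symp_vec, direction]

/-- The curve of planes spanned by `(ζ, 0, …, 0, 1, 0)` and `(0, …, 0, 0, 1)`. -/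
noncomputable def curve (n : ℕ) (hn : 1 ≤ n) (ζ : ℂ) : space n :=
  ⟨Gr.ofGraph (Gr.stdFrame (EuclideanSpace ℂ (Fin 2)) (EuclideanSpace ℂ (Fin (2 * n))))
    (ζ • direction n hn), fun h => by
      have := h _ (vec_mem 0 _) _ (vec_mem 1 _)
      rw [symp_vec_direction] at this
      simp at this⟩

theorem normFn_curve (n : ℕ) (hn : 1 ≤ n) (ζ : ℂ) : normFn (curve n hn ζ) = 1 + ‖ζ‖ ^ 2 := by
  rw [normFn_eq_coordNorm (curve n hn ζ) rfl (by rw [symp_vec_direction]; simp), coordNorm, ratio,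
    symp_vec_direction, WithLp.prod_norm_sq_eq_of_L2, WithLp.prod_norm_sq_eq_of_L2,
    WithLp.prod_inner_apply]
  simp [vec, Gr.stdFrame, direction, norm_smul, EuclideanSpace.inner_single_left]

theorem chartAt_curve (n : ℕ) (hn : 1 ≤ n) (ζ : ℂ) :
    chartAt (EuclideanSpace ℂ (Fin 2) →L[ℂ] EuclideanSpace ℂ (Fin (2 * n))) (curve n hn ζ) =
      chartAt _ (curve n hn 0) :=
  TopologicalSpace.Opens.chartAt_eq_of_eq
    (Gr.chartAt_eq_of_frameAt_eq ((Gr.frameAt_ofGraph_stdFrame (ζ • direction n hn)).trans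
      (Gr.frameAt_ofGraph_stdFrame ((0 : ℂ) • direction n hn)).symm))

theorem extChartAt_curve (n : ℕ) (hn : 1 ≤ n) (ζ : ℂ) :
    extChartAt (model n) (curve n hn 0) (curve n hn ζ) = ζ • direction n hn :=
  Gr.chartAt_ofGraph_stdFrame ((0 : ℂ) • direction n hn) (ζ • direction n hn)

theorem val_extChartAt_symm_curve (n : ℕ) (hn : 1 ≤ n) :
    ∀ᶠ T in 𝓝 (0 : EuclideanSpace ℂ (Fin 2) →L[ℂ] EuclideanSpace ℂ (Fin (2 * n))),
      ((extChartAt (model n) (curve n hn 0)).symm T).1 =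
        Gr.ofGraph (Gr.stdFrame (EuclideanSpace ℂ (Fin 2)) (EuclideanSpace ℂ (Fin (2 * n)))) T := by
  have h := TopologicalSpace.Opens.chartAt_subtype_val_symm_eventuallyEq (space n)
    (H := EuclideanSpace ℂ (Fin 2) →L[ℂ] EuclideanSpace ℂ (Fin (2 * n)))
    (x := curve n hn 0)
  have h0 : chartAt (EuclideanSpace ℂ (Fin 2) →L[ℂ] EuclideanSpace ℂ (Fin (2 * n)))
      (curve n hn 0).1 (curve n hn 0).1 = 0 :=
    (extChartAt_curve n hn 0).trans (zero_smul ℂ (direction n hn))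
  rw [h0] at h
  filter_upwards [h] with T hT
  exact hT.symm.trans (Gr.chartAt_symm_stdFrame ((0 : ℂ) • direction n hn) T)

/-- Multiplying the equation by $t$ brings it to the common form with $p=2n$ and right side
$t=1+(t-1)$, that is $c=1$. The only change from case II is then the factor $(1+ax)^{1/(2p)}$,
harmless on the unit disc. -/
theorem metric_not_isProjectivelyInduced (n : ℕ) (hn : 1 ≤ n) {f : ℝ → ℝ} (hf : IsProfile n f) :
    ¬ IsProjectivelyInduced (model n) (metric n f) := by
  have hn2 : 1 ≤ 2 * n := by omega
  have hn0 : (0 : ℝ) < n := by exact_mod_cast hn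
  -- This is the solution of $cp=a(p+1)$ for $c=1$, $p=2n$; being below $1$, it puts the second
  -- singularity $-1/a$ outside the closed unit disc.
  set a : ℝ := ((2 * n : ℕ) : ℝ) / (((2 * n : ℕ) : ℝ) + 1)
  have ha0 : 0 ≤ a := by positivity
  have ha1 : a < 1 := by
    rw [div_lt_one (by positivity)]
    linarith
  obtain ⟨D, hD0, hD, hDx, hDr⟩ :=
    exists_primitive_radialSlope ha0 ha1 (1 / (2 * ((2 * n : ℕ) : ℝ)))
  have hu : DifferentiableOn ℝ (derivWithin f (Ici 1)) (Ici 1) :=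
    (hf.contDiffOn.derivWithin (uniqueDiffOn_Ici 1) (m := 1) (by norm_num)).differentiableOn
      (by norm_num)
  have hode : ∀ t ∈ Ici (1 : ℝ), (2 * t - 1) * t ^ (2 * n - 1) *
      derivWithin f (Ici 1) t ^ (2 * (2 * n)) + 2 * (t - 1) * t ^ (2 * n) *
        derivWithin f (Ici 1) t ^ (2 * (2 * n) - 1) *
          derivWithin (derivWithin f (Ici 1)) (Ici 1) t = 1 + 1 * (t - 1) := by
    intro t ht
    have h1 := hf.ode t ht
    have e1 : t ^ (2 * n - 1) = t * t ^ (2 * n - 2) := by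
      rw [← pow_succ']; congr 1; omega
    have e2 : t ^ (2 * n) = t * t ^ (2 * n - 1) := by
      rw [← pow_succ']; congr 1; omega
    have e3 : 2 * (2 * n) = 4 * n := by ring
    rw [e2, e1, e3]
    rw [e1] at h1
    linear_combination t * h1
  have hrad : ∀ t : ℝ, 1 ≤ t → t < 2 → f t = f 1 + (D ((t - 1 : ℝ) : ℂ)).re := fun t h1 h2 =>
    profile_eq_primitive hf.contDiffOn (fun t ht => eq_radialSlope_of_ode hn2 ha0 (c := 1)
      (by simp only [a]; field_simp) hu hf.deriv_pos hode ht) hD0 hDx h1 h2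
  refine not_isProjectivelyInduced_of_curve ha0 ha1 (by positivity) hD0 hD hDx hDr
    (c := curve n hn) (v := direction n hn) (C := f 1) (fun ζ => ?_) (extChartAt_curve n hn) ?_ ?_
  · simp only [extChartAt, chartAt_curve n hn ζ]
  · have hne : ∀ᶠ T in 𝓝 (0 : EuclideanSpace ℂ (Fin 2) →L[ℂ] EuclideanSpace ℂ (Fin (2 * n))),
        symp (vec 0 T) (vec 1 T) ≠ 0 :=
      (contDiff_symp_vec n).continuous.continuousAt.eventually_ne (by rw [symp_vec_zero]; simp)
    refine contDiffAt_radial_comp hD hrad (contDiffAt_coordNorm n) ?_ ?_ ?_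
    · have h := normFn_curve n hn 0
      rw [normFn_eq_coordNorm (T := (0 : ℂ) • direction n hn) (curve n hn 0) rfl
        (by rw [symp_vec_direction]; simp)] at h
      exact (congrArg coordNorm (zero_smul ℂ (direction n hn))).symm.trans (h.trans (by simp))
    · filter_upwards [hne, val_extChartAt_symm_curve n hn] with T h1 h2
      simp only [Function.comp_apply]
      rw [normFn_eq_coordNorm _ h2 h1]
    · filter_upwards [hne, val_extChartAt_symm_curve n hn] with T h1 h2
      rw [← normFn_eq_coordNorm _ h2 h1]
      exact one_le_normFn _
  · have hc : ∀ᶠ ζ in 𝓝 (0 : ℂ), 1 + ‖ζ‖ ^ 2 < 2 := by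
      have : Continuous fun ζ : ℂ => 1 + ‖ζ‖ ^ 2 := by fun_prop
      exact this.continuousAt.eventually (gt_mem_nhds (by norm_num))
    filter_upwards [hc] with ζ h1
    rw [normFn_curve, hrad _ (by linarith [sq_nonneg ‖ζ‖]) h1, add_sub_cancel_left]

end MIII

theorem theorem1p1 (n : ℕ) (hn : 1 ≤ n) :
    (∀ f : ℝ → ℝ, MII.IsProfile n f →
      ¬ IsProjectivelyInduced (MII.model n) (MII.metric n f)) ∧
    (∀ f : ℝ → ℝ, MIII.IsProfile n f →
      ¬ IsProjectivelyInduced (MIII.model n) (MIII.metric n f)) :=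
  ⟨fun _ hf => MII.metric_not_isProjectivelyInduced n hn hf,
    fun _ hf => MIII.metric_not_isProjectivelyInduced n hn hf⟩
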